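/- Let $f(x)=\log_2(x+1)$, and let $S_0=(c_{00},\|\cdot\|)$ be the space of finitely supported real sequences with Schlumprecht's norm, the unique norm satisfying $$\|x\|=\max\Bigl\{\|x\|_\infty,\ \sup f(N)^{-1}\sum_{i=1}^N\|E_ix\|\Bigr\},$$ the supremum being over all $N\ge 2$ and all finite sets $E_1<\dots<E_N$ of positive integers, where $E<F$ means that every element of $E$ is smaller than every element of $F$, and $Ex$ is the coordinate projection of $x$ onto $E$. Let $S$ be the completion of $S_0$ (Schlumprecht's Banach space). Vectors, or functionals on $S_0$, are called successive, $x_1<\dots<x_N$, if their supports are (the support of a functional $x^*$ being $\{i: x^*(e_i)\ne0\}$). Definitions. For a normed space $X$, a subset $A$ of the unit sphere of $X$ is asymptotic if it meets every infinite-dimensional (not necessarily closed) linear subspace of $X$. Sets $A_1,A_2,\dots$ in the unit sphere of $X$ and $A_1^*,A_2^*,\dots$ in the closed unit ball of $X^*$ form an asymptotic biorthogonal system with constant $\delta$ if every $A_n$ is asymptotic; for every $n$ and every $x\in A_n$ there is $x^*\in A_n^*$ with $x^*(x)>1-\delta$; and $|x^*(x)|<\delta$ whenever $n\neq m$, $x\in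 A_n$, $x^*\in A_m^*$. A vector $x\in S_0$ is an $\ell_{1+}^n$-average with constant $C$ if $\|x\|=1$ and $x=x_1+\dots+x_n$ for some non-zero $x_1<\dots<x_n$ with $\|x_i\|\le C/n$ for all $i$. Put $M_f(t)=f^{-1}(36t^2)=2^{36t^2}-1$. For $\epsilon>0$ put $\epsilon'=\min\{\epsilon,1\}$; a sequence $x_1<\dots<x_N$ in $S_0$ is a rapidly increasing sequence of $\ell_{1+}$-averages (R.I.S.) of length $N$ with constant $1+\epsilon$ if there are $n_1,\dots,n_N$ such that $x_k$ is an $\ell_{1+}^{n_k}$-average with constant $1+\epsilon$ for each $k$, $n_1\ge 2(1+\epsilon)M_f(N/\epsilon')/(\epsilon'f'(1))$, and $\frac{\epsilon'}{2}f(n_k)^{1/2}\ge|\mathrm{supp}(x_{k-1})|$ for $k=2,\dots,N$. An equivalent norm $|||\cdot|||$ on $X$ being given, a basic sequence $(x_n)$ in $X$ (a Schauder basis of its closed linear span) is $C$-unconditional for it if $|||\sum\epsilon_na_nx_n|||\le C\,|||\sum a_nx_n|||$ for all finitely supported real sequences $(a_n)$ and all real $(\epsilon_n)$ with $|\epsilon_n|\le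 1$. The space $X$ is $\lambda$-distortable if it has an equivalent norm $|||\cdot|||$ such that $\sup\{|||y|||/|||z|||: y,z\in Z,\ \|y\|=\|z\|=1\}\ge\lambda$ for every infinite-dimensional linear subspace $Z\subset X$, and arbitrarily distortable if this holds for every $\lambda$. Theorem. (1) Let $\delta\in(0,1)$. There are sequences of integers $N_1<N_2<\dots$ with $f(N_1)/N_1<\delta/2$, $f(N_1)>8\delta^{-1}$ and $N_j>M_f(2N_{j-1})$ for all $j>1$. For every such sequence, let $A_k$ be the set of norm-1 vectors of $S_0$ of the form $\sum_{i=1}^{N_k}x_i$, where $x_1,\dots,x_{N_k}$ is a scalar multiple of a R.I.S. of length $N_k$ with constant $1+\delta/2$, and let $A_k^*$ be the set of functionals $f(N_k)^{-1}\sum_{i=1}^{N_k}x_i^*$ with $x_1^*<\dots<x_{N_k}^*$ and $\|x_i^*\|\le1$ for each $i$. Then $A_1,A_2,\dots$ and $A_1^*,A_2^*,\dots$ form an asymptotic biorthogonal system with constant $\delta$ in $S_0$. Moreover the Banach space $S$ also contains an asymptotic biorthogonal system with constant $\delta$. (2) For every $C$, each of the spaces $S_0$ and $S$ has an equivalent norm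 for which it contains no $C$-unconditional basic sequence. (3) Each of the spaces $S_0$ and $S$ is arbitrarily distortable. -/

import Mathlib

open Filter Topology

/-! ## Asymptotic sets, renormings and distortion in a general real normed space -/

section General

variable {X : Type*} [NormedAddCommGroup X] [NormedSpace ℝ X]

/-- A subset of the unit sphere is asymptotic if it meets every infinite-dimensional
(not necessarily closed) linear subspace. -/
def IsAsymptoticSet (A : Set X) : Prop :=
  A ⊆ Metric.sphere 0 1 ∧
    ∀ Y : Submodule ℝ X, ¬ FiniteDimensional ℝ Y → (A ∩ (Y : Set X)).Nonempty

/-- The sets `A n` of the unit sphere of `X` and the sets `A' n` of the unit ball of the dual of `X`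
form an asymptotic biorthogonal system with constant `δ`. -/
structure IsAsymptoticBiorthogonalSystem (δ : ℝ) (A : ℕ → Set X) (A' : ℕ → Set (X →L[ℝ] ℝ)) :
    Prop where
  dual_ball : ∀ n, A' n ⊆ Metric.closedBall 0 1
  asymptotic : ∀ n, IsAsymptoticSet (A n)
  norming : ∀ n, ∀ x ∈ A n, ∃ φ ∈ A' n, 1 - δ < φ x
  biorthogonal : ∀ n m, n ≠ m → ∀ x ∈ A n, ∀ φ ∈ A' m, |φ x| < δ

/-- `p` is a norm on `X` equivalent to the given one. -/
def IsEquivalentNorm (p : Seminorm ℝ X) : Prop :=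
  ∃ c K : ℝ, 0 < c ∧ 0 < K ∧ ∀ x, c * ‖x‖ ≤ p x ∧ p x ≤ K * ‖x‖

/-- `x` is a basic sequence: a Schauder basis of its closed linear span. (The notion does not change
when the norm is replaced by an equivalent one.) -/
def IsBasicSequence (x : ℕ → X) : Prop :=
  ∀ y ∈ (Submodule.span ℝ (Set.range x)).topologicalClosure,
    ∃! a : ℕ → ℝ, Tendsto (fun n => ∑ i ∈ Finset.range n, a i • x i) atTop (𝓝 y)

/-- `x` is a `C`-unconditional basic sequence for the norm `p` (equivalent to the given one).
The inequality for all finite sums is the same as the inequality for all convergent series. -/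
def IsUnconditionalBasicSequence (p : Seminorm ℝ X) (C : ℝ) (x : ℕ → X) : Prop :=
  IsBasicSequence x ∧
    ∀ (n : ℕ) (a ε : ℕ → ℝ), (∀ i, |ε i| ≤ 1) →
      p (∑ i ∈ Finset.range n, (ε i * a i) • x i) ≤ C * p (∑ i ∈ Finset.range n, a i • x i)

variable (X)

/-- `X` contains an asymptotic biorthogonal system with constant `δ`. -/
def ContainsAsymptoticBiorthogonalSystem (δ : ℝ) : Prop :=
  ∃ (A : ℕ → Set X) (A' : ℕ → Set (X →L[ℝ] ℝ)), IsAsymptoticBiorthogonalSystem δ A A'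

/-- `X` has an equivalent norm for which it contains no `C`-unconditional basic sequence. -/
def HasNormWithoutUnconditionalBasicSequence (C : ℝ) : Prop :=
  ∃ p : Seminorm ℝ X, IsEquivalentNorm p ∧ ∀ x : ℕ → X, ¬ IsUnconditionalBasicSequence p C x

/-- `X` is `r`-distortable. (The set below is non-empty and bounded above.) -/
def IsDistortable (r : ℝ) : Prop :=
  ∃ p : Seminorm ℝ X, IsEquivalentNorm p ∧
    ∀ Z : Submodule ℝ X, ¬ FiniteDimensional ℝ Z →
      r ≤ sSup {t : ℝ | ∃ y ∈ Z, ∃ z ∈ Z, ‖y‖ = 1 ∧ ‖z‖ = 1 ∧ t = p y / p z}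

/-- `X` is arbitrarily distortable. -/
def IsArbitrarilyDistortable : Prop := ∀ r : ℝ, IsDistortable X r

end General

namespace Schlumprecht

/-! ## The norm of Schlumprecht's space on finitely supported sequences -/

/-- The function `f(x) = log₂(x + 1)`. -/
noncomputable def f (x : ℝ) : ℝ := Real.logb 2 (x + 1)

theorem one_le_f {x : ℝ} (hx : 1 ≤ x) : 1 ≤ f x := by
  unfold f
  rw [Real.le_logb_iff_rpow_le (by norm_num) (by linarith)]
  norm_num
  linarith

/-- The coordinate projection onto `E`. -/
noncomputable def restrict (E : Finset ℕ) (x : ℕ →₀ ℝ) : ℕ →₀ ℝ := x.filter (fun i => i ∈ E)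

/-- A sequence of `N ≥ 2` finite sets `E 0 < ⋯ < E (N - 1)`. -/
structure SuccessiveSets where
  N : ℕ
  two_le : 2 ≤ N
  E : Fin N → Finset ℕ
  lt : ∀ i j, i < j → ∀ a ∈ E i, ∀ b ∈ E j, a < b

/-- The sup norm. -/
noncomputable def supNorm (x : ℕ →₀ ℝ) : ℝ := ⨆ i, |x i|

/-- The right-hand side of the implicit equation of the norm, for a function `q` in the place of
the norm: `‖x‖_∞ ∨ sup f(N)⁻¹ ∑ q(E_i x)`. -/
noncomputable def step (q : (ℕ →₀ ℝ) → ℝ) (x : ℕ →₀ ℝ) : ℝ :=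
  max (supNorm x) (⨆ S : SuccessiveSets, (f S.N)⁻¹ * ∑ i, q (restrict (S.E i) x))

/-- The increasing sequence of norms starting from the sup norm. -/
noncomputable def iterNorm : ℕ → (ℕ →₀ ℝ) → ℝ
  | 0 => supNorm
  | n + 1 => step (iterNorm n)

/-- Schlumprecht's norm. It is the only norm that solves the implicit equation `q = step q`, see
`schlNorm_eq_step` and `eq_schlNorm_of_eq_step` below. -/
noncomputable def schlNorm (x : ℕ →₀ ℝ) : ℝ := ⨆ n, iterNorm n x

/-- The norm of `ℓ₁`. -/
noncomputable def l1 (x : ℕ →₀ ℝ) : ℝ := x.sum fun _ a => |a|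

theorem l1_nonneg (x : ℕ →₀ ℝ) : 0 ≤ l1 x := Finset.sum_nonneg fun _ _ => abs_nonneg _

theorem abs_le_l1 (x : ℕ →₀ ℝ) (i : ℕ) : |x i| ≤ l1 x := by
  by_cases h : i ∈ x.support
  · exact Finset.single_le_sum (f := fun i => |x i|) (fun _ _ => abs_nonneg _) h
  · rw [Finsupp.notMem_support_iff.1 h, abs_zero]
    exact l1_nonneg x

theorem bddAbove_coord (x : ℕ →₀ ℝ) : BddAbove (Set.range fun i => |x i|) :=
  ⟨l1 x, by rintro _ ⟨i, rfl⟩; exact abs_le_l1 x i⟩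

theorem abs_le_supNorm (x : ℕ →₀ ℝ) (i : ℕ) : |x i| ≤ supNorm x := le_ciSup (bddAbove_coord x) i

theorem supNorm_nonneg (x : ℕ →₀ ℝ) : 0 ≤ supNorm x := (abs_nonneg _).trans (abs_le_supNorm x 0)

theorem supNorm_le_l1 (x : ℕ →₀ ℝ) : supNorm x ≤ l1 x := ciSup_le (abs_le_l1 x)

theorem restrict_add (E : Finset ℕ) (x y : ℕ →₀ ℝ) :
    restrict E (x + y) = restrict E x + restrict E y := Finsupp.filter_add

theorem restrict_smul (E : Finset ℕ) (c : ℝ) (x : ℕ →₀ ℝ) :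
    restrict E (c • x) = c • restrict E x := Finsupp.filter_smul

theorem sum_l1_restrict_le (S : SuccessiveSets) (x : ℕ →₀ ℝ) :
    ∑ i, l1 (restrict (S.E i) x) ≤ l1 x := by
  classical
  have h : ∀ i, l1 (restrict (S.E i) x) = ∑ a ∈ x.support.filter (· ∈ S.E i), |x a| := by
    intro i
    unfold l1 restrict Finsupp.sum
    rw [Finsupp.support_filter]
    refine Finset.sum_congr rfl fun a ha => ?_
    rw [Finsupp.filter_apply_pos _ _ (Finset.mem_filter.1 ha).2]
  simp_rw [h]
  rw [← Finset.sum_biUnion]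
  · exact Finset.sum_le_sum_of_subset_of_nonneg
      (Finset.biUnion_subset.2 fun i _ => Finset.filter_subset _ _) fun _ _ _ => abs_nonneg _
  · intro i _ j _ hij
    refine Finset.disjoint_left.2 fun a ha hb => ?_
    have ha := (Finset.mem_filter.1 ha).2
    have hb := (Finset.mem_filter.1 hb).2
    rcases lt_or_gt_of_ne hij with h | h
    · exact lt_irrefl _ (S.lt _ _ h a ha a hb)
    · exact lt_irrefl _ (S.lt _ _ h a hb a ha)

theorem one_le_f_N (S : SuccessiveSets) : 1 ≤ f S.N :=
  one_le_f (by exact_mod_cast (by norm_num : 1 ≤ 2).trans S.two_le)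

theorem inv_f_nonneg (S : SuccessiveSets) : 0 ≤ (f S.N)⁻¹ :=
  inv_nonneg.2 (zero_le_one.trans (one_le_f_N S))

theorem term_le_l1 {q : (ℕ →₀ ℝ) → ℝ} (hq : ∀ x, q x ≤ l1 x) (x : ℕ →₀ ℝ) (S : SuccessiveSets) :
    (f S.N)⁻¹ * ∑ i, q (restrict (S.E i) x) ≤ l1 x :=
  calc (f S.N)⁻¹ * ∑ i, q (restrict (S.E i) x)
      ≤ (f S.N)⁻¹ * l1 x := mul_le_mul_of_nonneg_left
        ((Finset.sum_le_sum fun _ _ => hq _).trans (sum_l1_restrict_le S x)) (inv_f_nonneg S)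
    _ ≤ 1 * l1 x := mul_le_mul_of_nonneg_right (inv_le_one_of_one_le₀ (one_le_f_N S)) (l1_nonneg x)
    _ = l1 x := one_mul _

theorem bddAbove_term {q : (ℕ →₀ ℝ) → ℝ} (hq : ∀ x, q x ≤ l1 x) (x : ℕ →₀ ℝ) :
    BddAbove (Set.range fun S : SuccessiveSets => (f S.N)⁻¹ * ∑ i, q (restrict (S.E i) x)) :=
  ⟨l1 x, by rintro _ ⟨S, rfl⟩; exact term_le_l1 hq x S⟩

instance : Nonempty SuccessiveSets :=
  ⟨⟨2, le_rfl, fun _ => ∅, fun _ _ _ a ha => absurd ha (Finset.notMem_empty a)⟩⟩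

theorem step_le_l1 {q : (ℕ →₀ ℝ) → ℝ} (hq : ∀ x, q x ≤ l1 x) (x : ℕ →₀ ℝ) : step q x ≤ l1 x :=
  max_le (supNorm_le_l1 x) (ciSup_le (term_le_l1 hq x))

theorem term_le_step {q : (ℕ →₀ ℝ) → ℝ} (hq : ∀ x, q x ≤ l1 x) (x : ℕ →₀ ℝ) (S : SuccessiveSets) :
    (f S.N)⁻¹ * ∑ i, q (restrict (S.E i) x) ≤ step q x :=
  (le_ciSup (bddAbove_term hq x) S).trans (le_max_right _ _)

theorem step_mono {q q' : (ℕ →₀ ℝ) → ℝ} (hq' : ∀ x, q' x ≤ l1 x) (h : ∀ x, q x ≤ q' x)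
    (x : ℕ →₀ ℝ) : step q x ≤ step q' x :=
  max_le (le_max_left _ _) (ciSup_le fun S =>
    (mul_le_mul_of_nonneg_left (Finset.sum_le_sum fun _ _ => h _) (inv_f_nonneg S)).trans
      (term_le_step hq' x S))

theorem iterNorm_le_l1 : ∀ (n : ℕ) (x : ℕ →₀ ℝ), iterNorm n x ≤ l1 x
  | 0, x => supNorm_le_l1 x
  | n + 1, x => step_le_l1 (iterNorm_le_l1 n) x

theorem iterNorm_le_succ : ∀ (n : ℕ) (x : ℕ →₀ ℝ), iterNorm n x ≤ iterNorm (n + 1) x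
  | 0, _ => le_max_left _ _
  | n + 1, x => step_mono (iterNorm_le_l1 (n + 1)) (iterNorm_le_succ n) x

theorem iterNorm_mono (x : ℕ →₀ ℝ) : Monotone fun n => iterNorm n x :=
  monotone_nat_of_le_succ fun n => iterNorm_le_succ n x

theorem bddAbove_iterNorm (x : ℕ →₀ ℝ) : BddAbove (Set.range fun n => iterNorm n x) :=
  ⟨l1 x, by rintro _ ⟨n, rfl⟩; exact iterNorm_le_l1 n x⟩

theorem iterNorm_le_schlNorm (n : ℕ) (x : ℕ →₀ ℝ) : iterNorm n x ≤ schlNorm x :=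
  le_ciSup (bddAbove_iterNorm x) n

theorem schlNorm_le_l1 (x : ℕ →₀ ℝ) : schlNorm x ≤ l1 x := ciSup_le fun n => iterNorm_le_l1 n x

theorem supNorm_add (x y : ℕ →₀ ℝ) : supNorm (x + y) ≤ supNorm x + supNorm y :=
  ciSup_le fun i => (abs_add_le (x i) (y i)).trans
    (add_le_add (abs_le_supNorm x i) (abs_le_supNorm y i))

theorem iterNorm_add : ∀ (n : ℕ) (x y : ℕ →₀ ℝ), iterNorm n (x + y) ≤ iterNorm n x + iterNorm n y
  | 0, x, y => supNorm_add x y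
  | n + 1, x, y => by
    refine max_le ((supNorm_add x y).trans (add_le_add (le_max_left _ _) (le_max_left _ _)))
      (ciSup_le fun S => ?_)
    refine le_trans ?_ (add_le_add (term_le_step (iterNorm_le_l1 n) x S)
      (term_le_step (iterNorm_le_l1 n) y S))
    rw [← mul_add, ← Finset.sum_add_distrib]
    refine mul_le_mul_of_nonneg_left (Finset.sum_le_sum fun i _ => ?_) (inv_f_nonneg S)
    rw [restrict_add]
    exact iterNorm_add n _ _

theorem supNorm_smul (c : ℝ) (x : ℕ →₀ ℝ) : supNorm (c • x) = |c| * supNorm x := by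
  unfold supNorm
  rw [Real.mul_iSup_of_nonneg (abs_nonneg c)]
  exact iSup_congr fun i => by rw [Finsupp.smul_apply, smul_eq_mul, abs_mul]

theorem iterNorm_smul : ∀ (n : ℕ) (c : ℝ) (x : ℕ →₀ ℝ), iterNorm n (c • x) = |c| * iterNorm n x
  | 0, c, x => supNorm_smul c x
  | n + 1, c, x => by
    change max _ _ = |c| * max _ _
    rw [mul_max_of_nonneg _ _ (abs_nonneg c), supNorm_smul, Real.mul_iSup_of_nonneg (abs_nonneg c)]
    congr 1
    refine iSup_congr fun S => ?_
    simp_rw [restrict_smul, iterNorm_smul n, ← Finset.mul_sum]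
    ring

theorem abs_le_schlNorm (x : ℕ →₀ ℝ) (i : ℕ) : |x i| ≤ schlNorm x :=
  (abs_le_supNorm x i).trans (iterNorm_le_schlNorm 0 x)

theorem schlNorm_add (x y : ℕ →₀ ℝ) : schlNorm (x + y) ≤ schlNorm x + schlNorm y :=
  ciSup_le fun n => (iterNorm_add n x y).trans
    (add_le_add (iterNorm_le_schlNorm n x) (iterNorm_le_schlNorm n y))

theorem schlNorm_smul (c : ℝ) (x : ℕ →₀ ℝ) : schlNorm (c • x) = |c| * schlNorm x := by
  unfold schlNorm
  rw [Real.mul_iSup_of_nonneg (abs_nonneg c)]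
  exact iSup_congr fun n => iterNorm_smul n c x

/-- Schlumprecht's norm solves the implicit equation
`‖x‖ = ‖x‖_∞ ∨ sup f(N)⁻¹ ∑ ‖E_i x‖`. -/
theorem schlNorm_eq_step (x : ℕ →₀ ℝ) : schlNorm x = step schlNorm x := by
  refine le_antisymm (ciSup_le fun n => ?_) (max_le (iterNorm_le_schlNorm 0 x) (ciSup_le fun S => ?_))
  · exact (iterNorm_le_succ n x).trans (step_mono schlNorm_le_l1 (iterNorm_le_schlNorm n) x)
  · have h : Tendsto (fun n => (f S.N)⁻¹ * ∑ i, iterNorm n (restrict (S.E i) x)) atTop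
        (𝓝 ((f S.N)⁻¹ * ∑ i, schlNorm (restrict (S.E i) x))) :=
      (tendsto_finsetSum _ fun i _ =>
        tendsto_atTop_ciSup (iterNorm_mono _) (bddAbove_iterNorm _)).const_mul _
    exact le_of_tendsto' h fun n =>
      (term_le_step (iterNorm_le_l1 n) x S).trans (iterNorm_le_schlNorm (n + 1) x)

theorem schlNorm_zero : schlNorm 0 = 0 := by
  have := schlNorm_smul 0 0
  rwa [zero_smul, abs_zero, zero_mul] at this

theorem le_of_eq_step {p q : (ℕ →₀ ℝ) → ℝ} (hp0 : p 0 = 0) (hp : ∀ x, p x = step p x)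
    (hq1 : ∀ x, q x ≤ l1 x) (hq : ∀ x, q x = step q x) : ∀ x, p x ≤ q x := by
  classical
  have hf : ∀ S : SuccessiveSets, 3 / 2 ≤ f S.N := by
    intro S
    have h2 : (2 : ℝ) ≤ S.N := by exact_mod_cast S.two_le
    unfold f
    rw [Real.le_logb_iff_rpow_le (by norm_num) (by linarith)]
    have h : (2 : ℝ) ^ (3 / 2 : ℝ) ≤ 3 := by
      rw [← Real.sqrt_sq (show (0 : ℝ) ≤ 3 by norm_num), div_eq_mul_inv,
        Real.rpow_mul (by norm_num), ← one_div, ← Real.sqrt_eq_rpow]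
      refine Real.sqrt_le_sqrt ?_
      norm_num [show (3 : ℝ) = ((3 : ℕ) : ℝ) by norm_num, Real.rpow_natCast]
    linarith
  have main : ∀ (n : ℕ) (x : ℕ →₀ ℝ), x.support.card = n → p x ≤ q x := by
    intro n
    induction n using Nat.strong_induction_on with
    | _ n ih =>
      intro x hx
      have hp_nonneg : 0 ≤ p x := by
        rw [hp x]
        exact (supNorm_nonneg x).trans (le_max_left _ _)
      have hbound : p x ≤ max (q x) (2 / 3 * p x) := by
        conv_lhs => rw [hp x]
        refine max_le (le_max_of_le_left ?_) (ciSup_le fun S => ?_)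
        · rw [hq x]
          exact le_max_left _ _
        · by_cases h : ∃ i, restrict (S.E i) x = x
          · refine le_max_of_le_right ?_
            obtain ⟨i, hi⟩ := h
            have hmem : ∀ a ∈ x.support, a ∈ S.E i := by
              intro a ha
              rw [← hi] at ha
              unfold restrict at ha
              rw [Finsupp.support_filter] at ha
              exact (Finset.mem_filter.1 ha).2
            have hsum : ∑ j, p (restrict (S.E j) x) = p x := by
              rw [Finset.sum_eq_single i, hi]
              · intro j _ hj
                have : restrict (S.E j) x = 0 := by
                  unfold restrict
                  ext a
                  rw [Finsupp.filter_apply, Finsupp.zero_apply]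
                  split_ifs with haj
                  · by_contra hne
                    have hai := hmem a (Finsupp.mem_support_iff.2 hne)
                    rcases lt_or_gt_of_ne hj with h | h
                    · exact lt_irrefl _ (S.lt _ _ h a haj a hai)
                    · exact lt_irrefl _ (S.lt _ _ h a hai a haj)
                  · rfl
                rw [this, hp0]
              · intro h
                exact absurd (Finset.mem_univ i) h
            rw [hsum]
            refine mul_le_mul_of_nonneg_right ?_ hp_nonneg
            rw [inv_le_comm₀ (by linarith [hf S]) (by norm_num)]
            linarith [hf S]
          · refine le_max_of_le_left (le_trans ?_ ((term_le_step hq1 x S).trans (hq x).ge))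
            refine mul_le_mul_of_nonneg_left (Finset.sum_le_sum fun i _ => ?_) (inv_f_nonneg S)
            refine ih _ ?_ _ rfl
            rw [← hx]
            refine Finset.card_lt_card (lt_of_le_of_ne ?_ fun heq => h ⟨i, ?_⟩)
            · unfold restrict
              rw [Finsupp.support_filter]
              exact Finset.filter_subset _ _
            · unfold restrict at heq ⊢
              rw [Finsupp.filter_eq_self_iff]
              intro a ha
              have ha := Finsupp.mem_support_iff.2 ha
              rw [← heq, Finsupp.support_filter] at ha
              exact (Finset.mem_filter.1 ha).2
      rcases le_max_iff.1 hbound with h | h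
      · exact h
      · have h0 : p x = 0 := by linarith
        rw [h0, hq x]
        exact (supNorm_nonneg x).trans (le_max_left _ _)
  exact fun x => main _ x rfl

/-- Schlumprecht's norm is the only solution of the implicit equation that vanishes at `0`. -/
theorem eq_schlNorm_of_eq_step {q : (ℕ →₀ ℝ) → ℝ} (h0 : q 0 = 0) (hq : ∀ x, q x = step q x) :
    q = schlNorm := by
  have h := le_of_eq_step h0 hq schlNorm_le_l1 schlNorm_eq_step
  exact funext fun x => le_antisymm (h x) (le_of_eq_step schlNorm_zero schlNorm_eq_step
    (fun y => (h y).trans (schlNorm_le_l1 y)) hq x)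

/-- `c₀₀` with Schlumprecht's norm. -/
def C00 : Type := ℕ →₀ ℝ

noncomputable instance : AddCommGroup C00 := inferInstanceAs (AddCommGroup (ℕ →₀ ℝ))

noncomputable instance : Module ℝ C00 := inferInstanceAs (Module ℝ (ℕ →₀ ℝ))

/-- The identification of `C00` with the finitely supported sequences. -/
noncomputable def C00.toFinsupp : C00 ≃ₗ[ℝ] (ℕ →₀ ℝ) := LinearEquiv.refl ℝ (ℕ →₀ ℝ)

noncomputable instance : Norm C00 := ⟨fun x => schlNorm x.toFinsupp⟩

theorem C00.norm_def (x : C00) : ‖x‖ = schlNorm x.toFinsupp := rfl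

theorem C00.core : NormedSpace.Core ℝ C00 where
  norm_nonneg x := (abs_nonneg _).trans (abs_le_schlNorm x.toFinsupp 0)
  norm_smul c x := by
    rw [C00.norm_def, map_smul, schlNorm_smul, Real.norm_eq_abs, C00.norm_def]
  norm_triangle x y := by
    rw [C00.norm_def, map_add]
    exact schlNorm_add _ _
  norm_eq_zero_iff x := by
    constructor
    · intro h
      refine C00.toFinsupp.injective (Finsupp.ext fun i => ?_)
      have := abs_le_schlNorm x.toFinsupp i
      rw [← C00.norm_def, h] at this
      rw [map_zero, Finsupp.zero_apply]
      exact abs_nonpos_iff.1 this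
    · rintro rfl
      exact schlNorm_zero

noncomputable instance : NormedAddCommGroup C00 := NormedAddCommGroup.ofCore C00.core

noncomputable instance : NormedSpace ℝ C00 := NormedSpace.ofCore C00.core

/-- Schlumprecht's Banach space: the completion of `C00`. -/
abbrev Space : Type := UniformSpace.Completion C00

/-! ## Rapidly increasing sequences of `ℓ₁₊`-averages -/

/-- The unit vector basis. -/
noncomputable def e (i : ℕ) : C00 := C00.toFinsupp.symm (Finsupp.single i 1)

/-- The support of a vector. -/
noncomputable def supp (x : C00) : Finset ℕ := x.toFinsupp.support

/-- The first `N` terms of the sequence of vectors `x` are successive. -/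
def SuccessiveVectors (N : ℕ) (x : ℕ → C00) : Prop :=
  ∀ i j, i < j → j < N → ∀ a ∈ supp (x i), ∀ b ∈ supp (x j), a < b

/-- The first `N` terms of the sequence of functionals `g` are successive (the support of a
functional `g` is the set of `a` with `g (e a) ≠ 0`). -/
def SuccessiveFunctionals (N : ℕ) (g : ℕ → (C00 →L[ℝ] ℝ)) : Prop :=
  ∀ i j, i < j → j < N → ∀ a, g i (e a) ≠ 0 → ∀ b, g j (e b) ≠ 0 → a < b

/-- `x` is an `ℓ₁₊ⁿ`-average with constant `C`. -/
def IsAverage (n : ℕ) (C : ℝ) (x : C00) : Prop :=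
  ‖x‖ = 1 ∧ ∃ y : ℕ → C00, (∀ i < n, y i ≠ 0) ∧ SuccessiveVectors n y ∧
    x = ∑ i ∈ Finset.range n, y i ∧ ∀ i < n, ‖y i‖ ≤ C * (n : ℝ)⁻¹

/-- `M_f(x) = f⁻¹(36 x²)`, where `f⁻¹(y) = 2 ^ y - 1`; see `f_Mf`. -/
noncomputable def Mf (x : ℝ) : ℝ := (2 : ℝ) ^ (36 * x ^ 2) - 1

theorem f_Mf (x : ℝ) : f (Mf x) = 36 * x ^ 2 := by
  unfold f Mf
  rw [sub_add_cancel, Real.logb_rpow (by norm_num) (by norm_num)]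

/-- The right derivative `f'(1)`. -/
noncomputable def fDerivOne : ℝ := derivWithin f (Set.Ici 1) 1

theorem fDerivOne_eq : fDerivOne = 1 / (2 * Real.log 2) := by
  have h : HasDerivAt f (1 / (1 + 1) / Real.log 2) 1 :=
    (((hasDerivAt_id (1 : ℝ)).add_const 1).log (by norm_num)).div_const (Real.log 2)
  unfold fDerivOne
  rw [h.hasDerivWithinAt.derivWithin (uniqueDiffOn_Ici 1 1 Set.self_mem_Ici)]
  rw [div_div]
  norm_num

/-- The first `N` terms of `x` are a rapidly increasing sequence of `ℓ₁₊`-averages (R.I.S.) for `f`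
of length `N` with constant `1 + ε`. Here `min ε 1` is `ε'`. -/
def IsRIS (N : ℕ) (ε : ℝ) (x : ℕ → C00) : Prop :=
  SuccessiveVectors N x ∧ ∃ n : ℕ → ℕ,
    (∀ k < N, IsAverage (n k) (1 + ε) (x k)) ∧
    2 * (1 + ε) * Mf (N / min ε 1) / (min ε 1 * fDerivOne) ≤ n 0 ∧
    ∀ k, k + 1 < N → ((supp (x k)).card : ℝ) ≤ min ε 1 / 2 * Real.sqrt (f (n (k + 1)))

/-! ## The asymptotic biorthogonal system -/

/-- The norm-one sums of multiples of a R.I.S. of length `N` with constant `1 + δ / 2`. -/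
def normalizedRISSums (δ : ℝ) (N : ℕ) : Set C00 :=
  {x | ‖x‖ = 1 ∧ ∃ (c : ℝ) (u : ℕ → C00), IsRIS N (δ / 2) u ∧ x = ∑ i ∈ Finset.range N, c • u i}

/-- The functionals `f(N)⁻¹ (g₁ + ⋯ + g_N)` with `g₁ < ⋯ < g_N` in the unit ball of the dual. -/
def averagedFunctionals (N : ℕ) : Set (C00 →L[ℝ] ℝ) :=
  {φ | ∃ g : ℕ → (C00 →L[ℝ] ℝ), SuccessiveFunctionals N g ∧ (∀ i < N, ‖g i‖ ≤ 1) ∧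
    φ = (f N)⁻¹ • ∑ i ∈ Finset.range N, g i}

/-- The growth conditions on the lengths. -/
def AreLengths (δ : ℝ) (N : ℕ → ℕ) : Prop :=
  StrictMono N ∧ f (N 0) / N 0 < δ / 2 ∧ 8 * δ⁻¹ < f (N 0) ∧ ∀ j, Mf (2 * N j) < N (j + 1)

end Schlumprecht

namespace Schlumprecht

/-! ## The functions `f` and `t / f t` -/

/-! A sum of `N` successive unit vectors has norm at least `N / f N`, and for a R.I.S. this is sharp
up to the factor `1 + ε + min ε 1` (`IsRIS.norm_estimates`). Hence a normalized R.I.S. sum of length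
`N` is almost normed by an average of `N` successive functionals, one for each vector
(`exists_norming`). Averages of a very different number `l` of functionals are almost zero on it. If
`l` is much larger than `N`, then for all vectors but one either the average is longer than `l` or
the support is tiny compared with `f l`; so the `l` functionals see essentially one vector, which is
negligible against `N / f N` (`RIS_term_le_of_long`). If `l` is much smaller, the sum splits into
`l` parts of total norm about `N / f (N / l)`, which is comparable with `N / f N`, and the factor `1
/ f l` makes the result small.

The upper estimates rest on `norm_proj_sum_le_divF`. The averages are cut into their small summands,
which are laid out as consecutive intervals on the line, so that a projection acquires a length `t`;
its norm is then at most about `t / f t`. The proof is by induction on the support through the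
implicit equation of the norm. It closes because `t / f t` is concave and `f` is submultiplicative,
which together give `sum_divF_le_f_mul`: passing to `m` parts costs at most the factor `f m`,
exactly what the equation divides by. Sets of negligible length are paid for by the growth of `f`
(`sub_mul_le_f_sub`).

The sets are asymptotic because every infinite-dimensional subspace contains long averages:
otherwise sums of `n ^ k` blocks would have norm at most `(n / (1 + ε)) ^ k`, against the lower
bound `n ^ k / f (n ^ k)` with a denominator of linear growth in `k` (`exists_average`). A
perturbation by blocks carries the system to the completion (`exists_near_asymptotic`).

The rest holds in any space with such systems. A small multiple of the norm plus the supremum over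
one dual set distorts. For unconditionality, sequences of functionals are coded in the manner of
Maurey and Rosenthal: the set from which the next functional is taken encodes all previous choices.
In every basic sequence one finds blocks whose plain sum is large on a coded functional, while every
coded functional sees only an initial segment of their alternating sum, up to small errors and one
stray term. -/

theorem f_zero : f 0 = 0 := by simp [f]

theorem f_one : f 1 = 1 := by
  unfold f
  norm_num

theorem f_mono {x y : ℝ} (hx : 0 ≤ x) (h : x ≤ y) : f x ≤ f y := by
  unfold f
  exact Real.logb_le_logb_of_le (by norm_num) (by linarith) (by linarith)

theorem f_nonneg {x : ℝ} (hx : 0 ≤ x) : 0 ≤ f x := f_zero ▸ f_mono le_rfl hx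

theorem f_pos {x : ℝ} (hx : 1 ≤ x) : 0 < f x := zero_lt_one.trans_le (one_le_f hx)

theorem f_eq (x : ℝ) : f x = Real.log (x + 1) / Real.log 2 := rfl

theorem f_le_iff {x y : ℝ} (hx : 0 ≤ x) : f x ≤ y ↔ x + 1 ≤ 2 ^ y := by
  unfold f
  rw [Real.logb_le_iff_le_rpow (by norm_num) (by linarith)]

/-- After exponentiation this reads `x * y + 1 ≤ (x + 1) ^ f y`. It is convexity of the power `f y ≥
1` at the point `2`, written as a convex combination of `1` and `x + 1`, together with `2 ^ f y = y
+ 1`. -/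
theorem f_mul_le {x y : ℝ} (hx : 1 ≤ x) (hy : 1 ≤ y) : f (x * y) ≤ f x * f y := by
  have hb : 1 ≤ f y := one_le_f hy
  have h2 : (2 : ℝ) ^ f y = y + 1 := by
    unfold f
    exact Real.rpow_logb (by norm_num) (by norm_num) (by linarith)
  have hx2 : (2 : ℝ) ^ f x = x + 1 := by
    unfold f
    exact Real.rpow_logb (by norm_num) (by norm_num) (by linarith)
  rw [f_le_iff (by positivity), Real.rpow_mul (by norm_num), hx2]
  have hx0 : 0 < x := by linarith
  have hc := (convexOn_rpow hb).2 (Set.mem_Ici.2 zero_le_one)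
    (Set.mem_Ici.2 (by linarith : (0 : ℝ) ≤ x + 1))
    (show 0 ≤ 1 - 1 / x by rw [sub_nonneg, div_le_one hx0]; exact hx)
    (show 0 ≤ 1 / x by positivity) (by ring)
  have he : (1 - 1 / x) • (1 : ℝ) + (1 / x) • (x + 1) = 2 := by
    simp only [smul_eq_mul]
    field_simp
    ring
  rw [he] at hc
  simp only [smul_eq_mul, h2, Real.one_rpow] at hc
  have h3 := mul_le_mul_of_nonneg_left hc hx0.le
  have h4 : x * ((1 - 1 / x) * 1 + 1 / x * (x + 1) ^ f y) = x - 1 + (x + 1) ^ f y := by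
    field_simp
  linarith

/-- `f t / t` is nonincreasing. -/
theorem mul_f_le_mul_f {s t : ℝ} (hs : 0 < s) (h : s ≤ t) : s * f t ≤ t * f s := by
  have h1 : 1 ≤ t / s := (one_le_div hs).2 h
  have h2 : (2 : ℝ) ^ f s = s + 1 := by
    unfold f
    exact Real.rpow_logb (by norm_num) (by norm_num) (by linarith)
  have : f t ≤ t / s * f s := by
    rw [f_le_iff (hs.le.trans h), mul_comm, Real.rpow_mul (by norm_num), h2]
    have := one_add_mul_self_le_rpow_one_add (show -1 ≤ s by linarith) h1
    rw [div_mul_cancel₀ _ hs.ne'] at this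
    rw [add_comm t, add_comm s]
    exact this
  calc s * f t ≤ s * (t / s * f s) := by gcongr
    _ = t * f s := by field_simp

theorem f_le_self {t : ℝ} (ht : 1 ≤ t) : f t ≤ t := by
  have := mul_f_le_mul_f one_pos ht
  rwa [f_one, one_mul, mul_one] at this

/-- On `[m, n]` the slope of `f` is at least `1 / ((n + 1) * log 2)`. This is what lets sets of norm
at most a tiny `l` be paid for by the increase of `f` from the number of remaining sets to the
number of all sets. -/
theorem sub_mul_le_f_sub {m n l c : ℝ} (hm : 0 ≤ m) (hmn : m ≤ n)
    (hc : n + 1 ≤ c) (hl : l * (c * Real.log 2) ≤ 1) :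
    (n - m) * l ≤ f n - f m := by
  have hl2 : 0 < Real.log 2 := Real.log_pos (by norm_num)
  rw [f_eq, f_eq, ← sub_div, le_div_iff₀ hl2, ← Real.log_div (by linarith) (by linarith)]
  have h := Real.one_sub_inv_le_log_of_pos (show 0 < (n + 1) / (m + 1) by
    apply div_pos <;> linarith)
  refine le_trans ?_ h
  rw [inv_div]
  have hn : 0 < n + 1 := by linarith
  have : 1 - (m + 1) / (n + 1) = (n - m) * (1 / (n + 1)) := by field_simp; ring
  rw [this, mul_assoc]
  refine mul_le_mul_of_nonneg_left ?_ (by linarith)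
  rw [le_div_iff₀ hn]
  rcases le_or_gt l 0 with h0 | h0
  · have : l * Real.log 2 * (n + 1) ≤ 0 :=
      mul_nonpos_of_nonpos_of_nonneg (mul_nonpos_of_nonpos_of_nonneg h0 hl2.le) hn.le
    linarith
  · refine le_trans ?_ hl
    rw [mul_assoc, mul_comm (Real.log 2)]
    gcongr

theorem integral_one_add_rpow {t : ℝ} (ht : 0 < t) :
    ∫ s in (0 : ℝ)..1, (1 + t) ^ s = t / Real.log (1 + t) := by
  have hL : 0 < Real.log (1 + t) := Real.log_pos (by linarith)
  have h : ∀ s : ℝ, (1 + t) ^ s = Real.exp (Real.log (1 + t) * s) := fun s =>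
    Real.rpow_def_of_pos (by linarith) s
  simp_rw [h]
  rw [intervalIntegral.integral_comp_mul_left (fun x => Real.exp x) hL.ne', integral_exp]
  rw [mul_one, mul_zero, Real.exp_log (by linarith), Real.exp_zero, smul_eq_mul]
  field_simp
  ring

/-- Up to the constant `log 2`, the function is the integral of `(1 + t) ^ s` over `s ∈ [0, 1]`, an
average of concave functions. -/
theorem concaveOn_div_f : ConcaveOn ℝ (Set.Ioi 0) fun t => t / f t := by
  have hl2 : 0 < Real.log 2 := Real.log_pos (by norm_num)
  have h1 : ConcaveOn ℝ (Set.Ioi 0) fun t : ℝ => ∫ s in (0 : ℝ)..1, (1 + t) ^ s := by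
    have hint : ∀ t : ℝ, 0 < t → IntervalIntegrable (fun s : ℝ => (1 + t) ^ s)
        MeasureTheory.volume 0 1 := fun t ht =>
      (Real.continuous_const_rpow (by linarith : 1 + t ≠ 0)).intervalIntegrable _ _
    refine ⟨convex_Ioi 0, fun x hx y hy a b ha hb hab => ?_⟩
    have hxy : 0 < a • x + b • y := convex_Ioi 0 hx hy ha hb hab
    rw [Set.mem_Ioi] at hx hy
    rw [smul_eq_mul, smul_eq_mul, ← intervalIntegral.integral_const_mul,
      ← intervalIntegral.integral_const_mul, ← intervalIntegral.integral_add
        ((hint x hx).const_mul a) ((hint y hy).const_mul b)]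
    refine intervalIntegral.integral_mono_on zero_le_one
      (((hint x hx).const_mul a).add ((hint y hy).const_mul b)) (hint _ hxy) fun s hs => ?_
    have := (Real.concaveOn_rpow hs.1 hs.2).2 (Set.mem_Ici.2 (by linarith : 0 ≤ 1 + x))
      (Set.mem_Ici.2 (by linarith : 0 ≤ 1 + y)) ha hb hab
    have he : a • (1 + x) + b • (1 + y) = 1 + (a • x + b • y) := by
      simp only [smul_eq_mul]
      linear_combination hab
    rw [he] at this
    exact this
  refine (h1.smul hl2.le).congr fun t ht => ?_
  simp only [smul_eq_mul]
  rw [integral_one_add_rpow ht, f_eq, add_comm 1 t]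
  field_simp

/-- The function `t / f t`, continued linearly to the left of `1`. -/
noncomputable def divF (t : ℝ) : ℝ := min t (t / f t)

theorem divF_of_le_one {t : ℝ} (h0 : 0 ≤ t) (h : t ≤ 1) : divF t = t := by
  refine min_eq_left ?_
  rcases h0.eq_or_lt with rfl | h0
  · simp
  · have h1 : f t ≤ 1 := f_one ▸ f_mono h0.le h
    have h2 : 0 < f t := by
      unfold f
      exact Real.logb_pos (by norm_num) (by linarith)
    rw [le_div_iff₀ h2]
    nlinarith

theorem divF_of_one_le {t : ℝ} (h : 1 ≤ t) : divF t = t / f t := by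
  refine min_eq_right ?_
  rw [div_le_iff₀ (f_pos h)]
  nlinarith [one_le_f h]

theorem one_le_divF {t : ℝ} (h : 1 ≤ t) : 1 ≤ divF t := by
  rw [divF_of_one_le h, one_le_div (f_pos h)]
  exact f_le_self h

theorem divF_mono {s t : ℝ} (hs : 0 ≤ s) (h : s ≤ t) : divF s ≤ divF t := by
  rcases le_total s 1 with h1 | h1
  · rw [divF_of_le_one hs h1]
    rcases le_total t 1 with h2 | h2
    · rwa [divF_of_le_one (hs.trans h) h2]
    · exact h1.trans (one_le_divF h2)
  · rw [divF_of_one_le h1, divF_of_one_le (h1.trans h), div_le_div_iff₀ (f_pos h1)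
      (f_pos (h1.trans h))]
    exact mul_f_le_mul_f (by linarith) h

theorem concaveOn_divF : ConcaveOn ℝ (Set.Ioi 0) divF :=
  (concaveOn_id (convex_Ioi 0)).inf concaveOn_div_f

theorem sum_divF_le {ι : Type*} (s : Finset ι) (hs : s.Nonempty) (l : ι → ℝ)
    (hl : ∀ i ∈ s, 0 < l i) :
    ∑ i ∈ s, divF (l i) ≤ s.card * divF ((∑ i ∈ s, l i) / s.card) := by
  have hc : 0 < (s.card : ℝ) := by exact_mod_cast hs.card_pos
  have := concaveOn_divF.le_map_sum (t := s) (w := fun _ => (s.card : ℝ)⁻¹) (p := l)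
    (fun _ _ => by positivity) (by simp [hc.ne']) (fun i hi => hl i hi)
  simp only [smul_eq_mul, ← Finset.mul_sum] at this
  rw [inv_mul_le_iff₀ hc] at this
  rwa [div_eq_inv_mul]

theorem sum_divF_le_of_le {ι : Type*} (s : Finset ι) (hs : s.Nonempty) (l : ι → ℝ)
    (hl : ∀ i ∈ s, 0 < l i) {L : ℝ} (hL : ∑ i ∈ s, l i ≤ L) :
    ∑ i ∈ s, divF (l i) ≤ s.card * divF (L / s.card) := by
  refine (sum_divF_le s hs l hl).trans (mul_le_mul_of_nonneg_left (divF_mono ?_ ?_) (by simp))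
  · exact div_nonneg (Finset.sum_nonneg fun i hi => (hl i hi).le) (by simp)
  · gcongr

/-- For `m ≤ L` this is submultiplicativity of `f` applied to `L = m * (L / m)`. For larger `m` the
left side is just `L`, and monotonicity of `f` suffices. -/
theorem nat_mul_divF_div_le {m : ℕ} (hm : 0 < m) {L : ℝ} (hL : 1 ≤ L) :
    m * divF (L / m) ≤ f m * divF L := by
  have hm1 : (1 : ℝ) ≤ m := by exact_mod_cast hm
  have hm0 : (0 : ℝ) < m := by linarith
  rcases le_total (m : ℝ) L with h | h
  · have h1 : 1 ≤ L / m := (one_le_div hm0).2 h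
    rw [divF_of_one_le h1, divF_of_one_le hL]
    have h2 : f L ≤ f m * f (L / m) := by
      have := f_mul_le hm1 h1
      rwa [mul_div_cancel₀ _ hm0.ne'] at this
    have h3 := f_pos h1
    have h4 := f_pos hL
    have h5 : (m : ℝ) * (L / m / f (L / m)) = L / f (L / m) := by field_simp
    rw [h5, ← mul_div_assoc, div_le_div_iff₀ h3 h4]
    nlinarith
  · rw [divF_of_le_one (by positivity) ((div_le_one hm0).2 h), mul_div_cancel₀ _ hm0.ne',
      divF_of_one_le hL, ← mul_div_assoc, le_div_iff₀ (f_pos hL), mul_comm]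
    gcongr
    exact f_mono (by linarith) h

/-- Concavity makes equal lengths the worst case. The factor `f s.card` is the one cancelled by
`f(N)⁻¹` in the implicit equation of the norm. -/
theorem sum_divF_le_f_mul {ι : Type*} (s : Finset ι) (l : ι → ℝ)
    (hl : ∀ i ∈ s, 0 < l i) {L : ℝ} (hL : ∑ i ∈ s, l i ≤ L) (h1 : 1 ≤ L) :
    ∑ i ∈ s, divF (l i) ≤ f s.card * divF L := by
  rcases s.eq_empty_or_nonempty with rfl | hs
  · simp [f_zero]
  · exact (sum_divF_le_of_le s hs l hl hL).trans (nat_mul_divF_div_le hs.card_pos h1)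

/-- Disjoint intervals in an interval. -/
theorem sum_length_le {ι : Type*} (s : Finset ι) (a b : ι → ℝ) (A B : ℝ) (hAB : A ≤ B)
    (hab : ∀ i ∈ s, a i ≤ b i) (hA : ∀ i ∈ s, A ≤ a i) (hB : ∀ i ∈ s, b i ≤ B)
    (hd : ∀ i ∈ s, ∀ j ∈ s, i ≠ j → b i ≤ a j ∨ b j ≤ a i) :
    ∑ i ∈ s, (b i - a i) ≤ B - A := by
  have h1 : MeasureTheory.volume (⋃ i ∈ s, Set.Ioc (a i) (b i)) =
      ∑ i ∈ s, ENNReal.ofReal (b i - a i) := by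
    rw [MeasureTheory.measure_biUnion_finset]
    · simp [Real.volume_Ioc]
    · intro i hi j hj hij
      refine Set.disjoint_left.2 fun t ht ht' => ?_
      rcases hd i hi j hj hij with h | h
      · exact absurd (ht.2.trans h) (not_le.2 ht'.1)
      · exact absurd (ht'.2.trans h) (not_le.2 ht.1)
    · exact fun i _ => measurableSet_Ioc
  have h2 : MeasureTheory.volume (⋃ i ∈ s, Set.Ioc (a i) (b i)) ≤
      MeasureTheory.volume (Set.Ioc A B) :=
    MeasureTheory.measure_mono (Set.iUnion₂_subset fun i hi =>
      Set.Ioc_subset_Ioc (hA i hi) (hB i hi))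
  rw [h1, Real.volume_Ioc, ← ENNReal.ofReal_sum_of_nonneg fun i hi => sub_nonneg.2 (hab i hi),
    ENNReal.ofReal_le_ofReal_iff (by linarith)] at h2
  exact h2

end Schlumprecht

namespace Schlumprecht

/-! ## Coordinate projections of `C00` -/

theorem restrict_apply (E : Finset ℕ) (x : ℕ →₀ ℝ) (a : ℕ) :
    restrict E x a = if a ∈ E then x a else 0 := by
  classical
  exact Finsupp.filter_apply _ _ _

theorem iterNorm_mono_abs (n : ℕ) : ∀ x y : ℕ →₀ ℝ, (∀ a, |x a| ≤ |y a|) →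
    iterNorm n x ≤ iterNorm n y := by
  have h0 : ∀ x y : ℕ →₀ ℝ, (∀ a, |x a| ≤ |y a|) → supNorm x ≤ supNorm y := fun x y h =>
    ciSup_le fun i => (h i).trans (abs_le_supNorm y i)
  induction n with
  | zero => exact h0
  | succ n ih =>
    intro x y h
    refine max_le ((h0 x y h).trans (le_max_left _ _)) (ciSup_le fun S => ?_)
    refine le_trans ?_ (term_le_step (iterNorm_le_l1 n) y S)
    refine mul_le_mul_of_nonneg_left (Finset.sum_le_sum fun i _ => ih _ _ fun a => ?_)
      (inv_f_nonneg S)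
    simp only [restrict_apply]
    split_ifs
    · exact h a
    · rfl

theorem schlNorm_mono_abs {x y : ℕ →₀ ℝ} (h : ∀ a, |x a| ≤ |y a|) : schlNorm x ≤ schlNorm y :=
  ciSup_mono (bddAbove_iterNorm y) fun n => iterNorm_mono_abs n x y h

namespace C00

/-- The coordinates of a vector. -/
noncomputable def coord (x : C00) (a : ℕ) : ℝ := x.toFinsupp a

@[simp] theorem coord_add (x y : C00) (a : ℕ) : (x + y).coord a = x.coord a + y.coord a := by
  simp [coord]

@[simp] theorem coord_smul (c : ℝ) (x : C00) (a : ℕ) : (c • x).coord a = c * x.coord a := by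
  simp [coord]

@[simp] theorem coord_sub (x y : C00) (a : ℕ) : (x - y).coord a = x.coord a - y.coord a := by
  simp [coord]

@[simp] theorem coord_zero (a : ℕ) : (0 : C00).coord a = 0 := by
  simp [coord]

@[simp] theorem coord_sum {ι : Type*} (s : Finset ι) (x : ι → C00) (a : ℕ) :
    (∑ i ∈ s, x i).coord a = ∑ i ∈ s, (x i).coord a := by
  simp [coord]

@[ext] theorem ext {x y : C00} (h : ∀ a, x.coord a = y.coord a) : x = y :=
  C00.toFinsupp.injective (Finsupp.ext h)

theorem mem_supp {x : C00} {a : ℕ} : a ∈ supp x ↔ x.coord a ≠ 0 := Finsupp.mem_support_iff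

theorem abs_coord_le (x : C00) (a : ℕ) : |x.coord a| ≤ ‖x‖ := abs_le_schlNorm x.toFinsupp a

theorem norm_mono {x y : C00} (h : ∀ a, |x.coord a| ≤ |y.coord a|) : ‖x‖ ≤ ‖y‖ :=
  schlNorm_mono_abs h

theorem eq_sum (x : C00) : x = ∑ a ∈ supp x, x.coord a • e a := by
  refine C00.toFinsupp.injective ?_
  simp only [map_sum, map_smul, e, LinearEquiv.apply_symm_apply]
  conv_lhs => rw [← Finsupp.sum_single x.toFinsupp]
  refine Finset.sum_congr rfl fun a _ => ?_
  simp [coord]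

theorem coord_e (a b : ℕ) : (e a).coord b = if a = b then 1 else 0 := by
  simp [coord, e, Finsupp.single_apply]

/-- The coordinate projection onto `E`. -/
noncomputable def proj (E : Finset ℕ) : C00 →L[ℝ] C00 :=
  LinearMap.mkContinuous
    { toFun := fun x => C00.toFinsupp.symm (restrict E x.toFinsupp)
      map_add' := fun x y => by rw [map_add, restrict_add, map_add]
      map_smul' := fun c x => by rw [map_smul, restrict_smul, map_smul, RingHom.id_apply] } 1
    fun x => by
      rw [one_mul]
      refine norm_mono fun a => ?_
      simp only [LinearMap.coe_mk, AddHom.coe_mk, coord, LinearEquiv.apply_symm_apply,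
        restrict_apply]
      split_ifs
      · rfl
      · rw [abs_zero]
        exact abs_nonneg _

theorem toFinsupp_proj (E : Finset ℕ) (x : C00) :
    (proj E x).toFinsupp = restrict E x.toFinsupp := LinearEquiv.apply_symm_apply _ _

@[simp] theorem coord_proj (E : Finset ℕ) (x : C00) (a : ℕ) :
    (proj E x).coord a = if a ∈ E then x.coord a else 0 := by
  unfold coord
  rw [toFinsupp_proj, restrict_apply]

theorem norm_proj_le (E : Finset ℕ) (x : C00) : ‖proj E x‖ ≤ ‖x‖ :=
  norm_mono fun a => by
    rw [coord_proj]
    split_ifs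
    · rfl
    · rw [abs_zero]
      exact abs_nonneg _

theorem supp_proj (E : Finset ℕ) (x : C00) : supp (proj E x) = supp x ∩ E := by
  ext a
  simp only [Finset.mem_inter, mem_supp, coord_proj]
  split_ifs <;> simp_all

theorem proj_proj (E F : Finset ℕ) (x : C00) : proj E (proj F x) = proj (E ∩ F) x := by
  ext a
  simp only [coord_proj, Finset.mem_inter]
  split_ifs <;> tauto

theorem proj_eq_zero {E : Finset ℕ} {x : C00} (h : ∀ a ∈ E, a ∉ supp x) : proj E x = 0 := by
  ext a
  rw [coord_proj, coord_zero]
  split_ifs with ha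
  · by_contra h'
    exact h a ha (mem_supp.2 h')
  · rfl

theorem proj_eq_self {E : Finset ℕ} {x : C00} (h : supp x ⊆ E) : proj E x = x := by
  ext a
  rw [coord_proj]
  split_ifs with ha
  · rfl
  · by_contra h'
    exact ha (h (mem_supp.2 (Ne.symm h')))

/-- The lower `f`-estimate. -/
theorem sum_norm_proj_le (S : SuccessiveSets) (x : C00) :
    (f S.N)⁻¹ * ∑ i, ‖proj (S.E i) x‖ ≤ ‖x‖ := by
  have h := term_le_step schlNorm_le_l1 x.toFinsupp S
  rw [← schlNorm_eq_step] at h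
  simpa only [norm_def, toFinsupp_proj] using h

theorem sum_norm_proj_le_card (S : SuccessiveSets) {x : C00} (hx : ∀ a, |x.coord a| ≤ 1) :
    ∑ i, ‖proj (S.E i) x‖ ≤ (supp x).card := by
  have h := sum_l1_restrict_le S x.toFinsupp
  have h1 : l1 x.toFinsupp ≤ (supp x).card := by
    unfold l1 Finsupp.sum
    refine (Finset.sum_le_card_nsmul _ _ 1 fun a _ => hx a).trans ?_
    simp [supp]
  refine le_trans (Finset.sum_le_sum fun i _ => ?_) (h.trans h1)
  rw [norm_def, toFinsupp_proj]
  exact schlNorm_le_l1 _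

theorem three_halves_le_f (S : SuccessiveSets) : 3 / 2 ≤ f S.N := by
  have h2 : (2 : ℝ) ≤ S.N := by exact_mod_cast S.two_le
  refine le_trans ?_ (f_mono (by norm_num) h2)
  unfold f
  rw [Real.le_logb_iff_rpow_le (by norm_num) (by norm_num)]
  have h : ((2 : ℝ) ^ (3 / 2 : ℝ)) ^ 2 ≤ 3 ^ 2 := by
    rw [← Real.rpow_natCast, ← Real.rpow_mul (by norm_num)]
    norm_num
  have := le_of_sq_le_sq h (by norm_num)
  linarith

/-- To bound the norm it is enough to consider the sup norm and the sums over `E₁ < ⋯ < E_N`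
such that the support is not contained in one of the sets. -/
theorem norm_le_of {x : C00} {B : ℝ} (hsup : ∀ a, |x.coord a| ≤ B)
    (h : ∀ S : SuccessiveSets, (∀ i, (supp (proj (S.E i) x)).card < (supp x).card) →
      (f S.N)⁻¹ * ∑ i, ‖proj (S.E i) x‖ ≤ B) : ‖x‖ ≤ B := by
  have hB : 0 ≤ B := (abs_nonneg _).trans (hsup 0)
  -- If one set contains the support, the others contribute nothing and the term is `‖x‖ / f N ≤ 2 /
  -- 3 * ‖x‖`, so it cannot be what determines a non-zero norm.
  have key : ‖x‖ ≤ max B (2 / 3 * ‖x‖) := by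
    conv_lhs => rw [norm_def, schlNorm_eq_step]
    refine max_le (le_max_of_le_left (ciSup_le hsup)) (ciSup_le fun S => ?_)
    have he : (f S.N)⁻¹ * ∑ i, schlNorm (restrict (S.E i) x.toFinsupp) =
        (f S.N)⁻¹ * ∑ i, ‖proj (S.E i) x‖ := by
      simp only [norm_def, toFinsupp_proj]
    rw [he]
    by_cases hS : ∀ i, (supp (proj (S.E i) x)).card < (supp x).card
    · exact le_max_of_le_left (h S hS)
    · refine le_max_of_le_right ?_
      push Not at hS
      obtain ⟨i, hi⟩ := hS
      have hsub : supp x ⊆ S.E i := by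
        rw [supp_proj] at hi
        have := Finset.eq_of_subset_of_card_le Finset.inter_subset_left hi
        exact Finset.inter_eq_left.1 this
      rw [Finset.sum_eq_single i, proj_eq_self hsub]
      · refine mul_le_mul_of_nonneg_right ?_ (norm_nonneg x)
        rw [inv_le_comm₀ (by linarith [three_halves_le_f S]) (by norm_num)]
        linarith [three_halves_le_f S]
      · intro j _ hj
        rw [proj_eq_zero, norm_zero]
        intro a haj hax
        have hai := hsub hax
        rcases lt_or_gt_of_ne hj with h | h
        · exact lt_irrefl _ (S.lt _ _ h a haj a hai)
        · exact lt_irrefl _ (S.lt _ _ h a hai a haj)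
      · exact fun h => absurd (Finset.mem_univ i) h
  rcases le_max_iff.1 key with h | h
  · exact h
  · linarith [norm_nonneg x]

end C00

open C00

/-! ## Successive vectors -/

theorem SuccessiveVectors.lt_of {N : ℕ} {x : ℕ → C00} (hx : SuccessiveVectors N x) {i j a b : ℕ}
    (hij : i < j) (hj : j < N) (ha : a ∈ supp (x i)) (hb : b ∈ supp (x j)) : a < b :=
  hx i j hij hj a ha b hb

theorem SuccessiveVectors.eq_of {N : ℕ} {x : ℕ → C00} (hx : SuccessiveVectors N x) {i j a : ℕ}
    (hi : i < N) (hj : j < N) (ha : a ∈ supp (x i)) (hb : a ∈ supp (x j)) : i = j := by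
  by_contra h
  rcases lt_or_gt_of_ne h with h | h
  · exact lt_irrefl _ (hx.lt_of h hj ha hb)
  · exact lt_irrefl _ (hx.lt_of h hi hb ha)

theorem SuccessiveVectors.coord_sum {N : ℕ} {x : ℕ → C00} (hx : SuccessiveVectors N x) {i a : ℕ}
    (hi : i < N) (ha : a ∈ supp (x i)) :
    (∑ j ∈ Finset.range N, x j).coord a = (x i).coord a := by
  rw [C00.coord_sum, Finset.sum_eq_single i]
  · intro j hj hji
    by_contra h
    exact hji (hx.eq_of (Finset.mem_range.1 hj) hi (mem_supp.2 h) ha)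
  · exact fun h => absurd (Finset.mem_range.2 hi) h

theorem SuccessiveVectors.supp_subset {N : ℕ} {x : ℕ → C00} (hx : SuccessiveVectors N x) {i : ℕ}
    (hi : i < N) : supp (x i) ⊆ supp (∑ j ∈ Finset.range N, x j) := by
  intro a ha
  rw [mem_supp, hx.coord_sum hi ha]
  exact mem_supp.1 ha

theorem exists_mem_supp_of_mem_sum {ι : Type*} {s : Finset ι} {x : ι → C00} {a : ℕ}
    (h : a ∈ supp (∑ i ∈ s, x i)) : ∃ i ∈ s, a ∈ supp (x i) := by
  rw [mem_supp, C00.coord_sum] at h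
  obtain ⟨i, hi, h⟩ := Finset.exists_ne_zero_of_sum_ne_zero h
  exact ⟨i, hi, mem_supp.2 h⟩

theorem supp_nonempty {x : C00} (hx : x ≠ 0) : (supp x).Nonempty := by
  rw [Finset.nonempty_iff_ne_empty]
  intro h
  refine hx (C00.ext fun a => ?_)
  by_contra h'
  have : a ∈ supp x := mem_supp.2 h'
  simp [h] at this

theorem supp_smul_subset (c : ℝ) (x : C00) : supp (c • x) ⊆ supp x := by
  intro a
  simp [mem_supp]

/-- The number of non-zero successive vectors is at most the size of the support of the sum. -/
theorem SuccessiveVectors.le_card {n : ℕ} {y : ℕ → C00} (hy : SuccessiveVectors n y)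
    (h0 : ∀ i < n, y i ≠ 0) : n ≤ (supp (∑ j ∈ Finset.range n, y j)).card := by
  have h : ∀ i, ∃ a, i < n → a ∈ supp (y i) := fun i => by
    by_cases hi : i < n
    · obtain ⟨a, ha⟩ := supp_nonempty (h0 i hi)
      exact ⟨a, fun _ => ha⟩
    · exact ⟨0, fun h => absurd h hi⟩
  choose a ha using h
  have := Finset.card_le_card_of_injOn (s := Finset.range n)
    (t := supp (∑ j ∈ Finset.range n, y j)) a
    (fun i hi => hy.supp_subset (by simpa using hi) (ha i (by simpa using hi)))
    (fun i hi j hj hij => hy.eq_of (by simpa using hi) (by simpa using hj)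
      (ha i (by simpa using hi)) (hij ▸ ha j (by simpa using hj)))
  simpa using this

/-- The successive sets given by the supports of successive vectors. -/
noncomputable def SuccessiveVectors.sets {N : ℕ} {x : ℕ → C00} (hx : SuccessiveVectors N x)
    (hN : 2 ≤ N) : SuccessiveSets where
  N := N
  two_le := hN
  E i := supp (x i)
  lt i j hij := hx i j hij j.2

theorem SuccessiveVectors.proj_sum {N : ℕ} {x : ℕ → C00} (hx : SuccessiveVectors N x) {i : ℕ}
    (hi : i < N) : proj (supp (x i)) (∑ j ∈ Finset.range N, x j) = x i := by
  ext a
  rw [coord_proj]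
  split_ifs with ha
  · exact hx.coord_sum hi ha
  · by_contra h
    exact ha (mem_supp.2 (Ne.symm h))

theorem SuccessiveVectors.le_norm_sum {N : ℕ} {x : ℕ → C00} (hx : SuccessiveVectors N x)
    (hN : 2 ≤ N) : (f N)⁻¹ * ∑ i ∈ Finset.range N, ‖x i‖ ≤ ‖∑ j ∈ Finset.range N, x j‖ := by
  refine le_trans (le_of_eq ?_) (sum_norm_proj_le (hx.sets hN) _)
  rw [← Fin.sum_univ_eq_sum_range (fun i => ‖x i‖)]
  exact congrArg _ (Finset.sum_congr rfl fun i _ => by rw [← hx.proj_sum i.2]; rfl)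

theorem SuccessiveVectors.smul {N : ℕ} {x : ℕ → C00} (hx : SuccessiveVectors N x) (c : ℝ) :
    SuccessiveVectors N fun i => c • x i :=
  fun i j hij hj a ha b hb => hx i j hij hj a (supp_smul_subset _ _ ha) b (supp_smul_subset _ _ hb)

end Schlumprecht

namespace Schlumprecht
open C00

/-! ## Estimates for averages and rapidly increasing sequences -/

theorem IsAverage.pos {n : ℕ} {C : ℝ} {x : C00} (h : IsAverage n C x) : 0 < n := by
  obtain ⟨h1, y, -, -, hx, -⟩ := h
  rcases Nat.eq_zero_or_pos n with rfl | h
  · simp [hx] at h1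
  · exact h

/-- Each set of `S` and each summand of the average occupy successive positions, so the pairs that
meet form a staircase. On it the map `(i, r) ↦ i + r` is injective, hence there are at most `S.N +
n` such pairs, each contributing at most `C / n`. -/
theorem IsAverage.sum_norm_proj_le {n : ℕ} {C : ℝ} {x : C00} (h : IsAverage n C x)
    (S : SuccessiveSets) : ∑ i, ‖proj (S.E i) x‖ ≤ C * (1 + S.N / n) := by
  classical
  have hn := h.pos
  obtain ⟨-, y, -, hy, rfl, hC⟩ := h
  have hn' : (0 : ℝ) < n := by exact_mod_cast hn
  have hc0 : 0 ≤ C * (n : ℝ)⁻¹ := (norm_nonneg _).trans (hC 0 hn)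
  let T : Finset (Fin S.N × ℕ) := (Finset.univ ×ˢ Finset.range n).filter
    fun q => ∃ a ∈ S.E q.1, a ∈ supp (y q.2)
  have hT : T.card ≤ S.N + n := by
    have := Finset.card_le_card_of_injOn (s := T) (t := Finset.range (S.N + n))
      (fun q => (q.1 : ℕ) + q.2) ?_ ?_
    · simpa using this
    · intro q hq
      have := Finset.mem_range.1 (Finset.mem_product.1 (Finset.mem_filter.1 hq).1).2
      have h2 := q.1.2
      simp only [Finset.coe_range, Set.mem_Iio]
      omega
    · rintro ⟨i, r⟩ hq ⟨j, t⟩ hq' hij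
      simp only at hij
      obtain ⟨hq1, a, ha, ha'⟩ := Finset.mem_filter.1 hq
      obtain ⟨hq1', b, hb, hb'⟩ := Finset.mem_filter.1 hq'
      have hr := Finset.mem_range.1 (Finset.mem_product.1 hq1).2
      have ht := Finset.mem_range.1 (Finset.mem_product.1 hq1').2
      simp only at ha ha' hb hb' hr ht
      rcases lt_trichotomy i j with h | h | h
      · have h1 := S.lt i j h a ha b hb
        have h2 := hy.lt_of (show t < r by rw [Fin.lt_def] at h; omega) hr hb' ha'
        omega
      · subst h
        simp only [Prod.mk.injEq, true_and]
        omega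
      · have h1 := S.lt j i h b hb a ha
        have h2 := hy.lt_of (show r < t by rw [Fin.lt_def] at h; omega) ht ha' hb'
        omega
  calc ∑ i, ‖proj (S.E i) (∑ r ∈ Finset.range n, y r)‖
      ≤ ∑ i, ∑ r ∈ Finset.range n, ‖proj (S.E i) (y r)‖ :=
        Finset.sum_le_sum fun i _ => by
          rw [map_sum]
          exact norm_sum_le _ _
    _ = ∑ q ∈ Finset.univ ×ˢ Finset.range n, ‖proj (S.E q.1) (y q.2)‖ :=
        (Finset.sum_product (f := fun q : Fin S.N × ℕ => ‖proj (S.E q.1) (y q.2)‖) ..).symm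
    _ = ∑ q ∈ T, ‖proj (S.E q.1) (y q.2)‖ := by
        refine (Finset.sum_filter_of_ne fun q _ hq => ?_).symm
        by_contra h
        push Not at h
        exact hq (by rw [proj_eq_zero h, norm_zero])
    _ ≤ ∑ q ∈ T, C * (n : ℝ)⁻¹ := Finset.sum_le_sum fun q hq =>
        (norm_proj_le _ _).trans
          (hC _ (Finset.mem_range.1 (Finset.mem_product.1 (Finset.mem_filter.1 hq).1).2))
    _ = T.card * (C * (n : ℝ)⁻¹) := by rw [Finset.sum_const, nsmul_eq_mul]
    _ ≤ (S.N + n : ℕ) * (C * (n : ℝ)⁻¹) := by gcongr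
    _ = C * (1 + S.N / n) := by
        push_cast
        field_simp
        ring

/-! ### Sums over successive sets applied to a R.I.S. -/

section RIS

variable {N : ℕ} {ε : ℝ} {u : ℕ → C00} {n : ℕ → ℕ}

/-- An average of length `n k` has at least `n k` points in its support, and the support is bounded
by the square-root condition on the next length. -/
theorem RIS_monotone (havg : ∀ k < N, IsAverage (n k) (1 + ε) (u k))
    (hcard : ∀ k, k + 1 < N →
      ((supp (u k)).card : ℝ) ≤ min ε 1 / 2 * Real.sqrt (f (n (k + 1)))) :
    ∀ k l, k ≤ l → l < N → n k ≤ n l := by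
  have hstep : ∀ k, k + 1 < N → n k ≤ n (k + 1) := by
    intro k hk
    have h1 : n k ≤ (supp (u k)).card := by
      obtain ⟨-, y, h0, hy, hx, -⟩ := havg k (by omega)
      rw [hx]
      exact hy.le_card h0
    have hn1 : (1 : ℝ) ≤ n (k + 1) := by exact_mod_cast (havg (k + 1) hk).pos
    have hf1 := one_le_f hn1
    have h2 : Real.sqrt (f (n (k + 1))) ≤ n (k + 1) :=
      (Real.sqrt_le_sqrt (f_le_self hn1)).trans (by
        rw [Real.sqrt_le_left (by linarith)]
        nlinarith)
    have h3 : (n k : ℝ) ≤ n (k + 1) := by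
      have h4 : ((n k : ℕ) : ℝ) ≤ (supp (u k)).card := by exact_mod_cast h1
      have h5 : min ε 1 / 2 * Real.sqrt (f (n (k + 1))) ≤ 1 * Real.sqrt (f (n (k + 1))) := by
        gcongr
        linarith [min_le_right ε 1]
      linarith [hcard k hk]
    exact_mod_cast h3
  intro k l hkl
  induction l, hkl using Nat.le_induction with
  | base => exact fun _ => le_rfl
  | succ l hkl ih => exact fun h => (ih (by omega)).trans (hstep l h)

/-- Compared with the number of sets, a vector is either a long average, hence nearly flat, or has a
small support and a small `ℓ₁` norm. Only the vector at the transition escapes both cases, and its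
contribution is at most its norm, which is `1`. -/
theorem RIS_term_le (hε : 0 < ε)
    (havg : ∀ k < N, IsAverage (n k) (1 + ε) (u k))
    (hcard : ∀ k, k + 1 < N →
      ((supp (u k)).card : ℝ) ≤ min ε 1 / 2 * Real.sqrt (f (n (k + 1))))
    (S : SuccessiveSets) :
    (f S.N)⁻¹ * ∑ i, ‖proj (S.E i) (∑ k ∈ Finset.range N, u k)‖ ≤
      1 + N * (min ε 1 / 2 / Real.sqrt (f S.N) + 2 * (1 + ε) / f S.N) := by
  classical
  have hmono := RIS_monotone havg hcard
  have hη : 0 < min ε 1 := lt_min hε one_pos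
  have hf : 0 < f S.N := zero_lt_one.trans_le (one_le_f_N S)
  set c := min ε 1 / 2 / Real.sqrt (f S.N) + 2 * (1 + ε) / f S.N with hc
  have hc1 : 0 ≤ min ε 1 / 2 / Real.sqrt (f S.N) := by positivity
  have hc2 : 0 ≤ 2 * (1 + ε) / f S.N := by positivity
  have hlong : ∀ k < N, S.N < n k → (f S.N)⁻¹ * ∑ i, ‖proj (S.E i) (u k)‖ ≤ c := by
    intro k hk hn
    have h1 := (havg k hk).sum_norm_proj_le S
    have hn0 : (0 : ℝ) < n k := by exact_mod_cast (havg k hk).pos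
    have h2 : (S.N : ℝ) / n k ≤ 1 := (div_le_one hn0).2 (by exact_mod_cast hn.le)
    calc (f S.N)⁻¹ * ∑ i, ‖proj (S.E i) (u k)‖ ≤ (f S.N)⁻¹ * ((1 + ε) * (1 + 1)) := by
          gcongr
          exact h1.trans (by gcongr)
      _ = 2 * (1 + ε) / f S.N := by ring
      _ ≤ c := by linarith
  have hshort : ∀ k, k + 1 < N → n (k + 1) ≤ S.N →
      (f S.N)⁻¹ * ∑ i, ‖proj (S.E i) (u k)‖ ≤ c := by
    intro k hk hn
    have h1 : ∑ i, ‖proj (S.E i) (u k)‖ ≤ (supp (u k)).card :=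
      sum_norm_proj_le_card S fun a => (abs_coord_le _ a).trans (havg k (by omega)).1.le
    have h2 : Real.sqrt (f (n (k + 1))) ≤ Real.sqrt (f S.N) :=
      Real.sqrt_le_sqrt (f_mono (by positivity) (by exact_mod_cast hn))
    calc (f S.N)⁻¹ * ∑ i, ‖proj (S.E i) (u k)‖
        ≤ (f S.N)⁻¹ * (min ε 1 / 2 * Real.sqrt (f S.N)) := by
          gcongr
          exact (h1.trans (hcard k hk)).trans (by gcongr)
      _ = min ε 1 / 2 / Real.sqrt (f S.N) := by
          have h3 := Real.sq_sqrt hf.le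
          have h4 : 0 < Real.sqrt (f S.N) := Real.sqrt_pos.2 hf
          rw [inv_mul_eq_div, div_eq_div_iff hf.ne' h4.ne']
          linear_combination (min ε 1 / 2) * h3
      _ ≤ c := by linarith
  -- The exceptional index is the last one with `n t ≤ S.N`; when there is none, every vector is in
  -- the long case and any `t` will do.
  obtain ⟨t, ht⟩ : ∃ t, ∀ k < N, k ≠ t → S.N < n k ∨ (k + 1 < N ∧ n (k + 1) ≤ S.N) := by
    by_cases hne : ((Finset.range N).filter fun k => n k ≤ S.N).Nonempty
    · obtain ⟨t, ht, hmax⟩ := Finset.exists_max_image _ id hne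
      simp only [Finset.mem_filter, Finset.mem_range, id] at ht hmax
      refine ⟨t, fun k hk hkt => ?_⟩
      rcases lt_or_gt_of_ne hkt with h | h
      · exact Or.inr ⟨by omega, (hmono (k + 1) t h ht.1).trans ht.2⟩
      · refine Or.inl (not_le.1 fun h' => ?_)
        have := hmax k ⟨hk, h'⟩
        omega
    · refine ⟨0, fun k hk _ => Or.inl (not_le.1 fun h' => hne ⟨k, ?_⟩)⟩
      exact Finset.mem_filter.2 ⟨Finset.mem_range.2 hk, h'⟩
  have hterm : ∀ k ∈ Finset.range N, (f S.N)⁻¹ * ∑ i, ‖proj (S.E i) (u k)‖ ≤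
      c + if k = t then 1 else 0 := by
    intro k hk
    rw [Finset.mem_range] at hk
    split_ifs with h
    · have h1 := C00.sum_norm_proj_le S (u k)
      rw [(havg k hk).1] at h1
      linarith
    · rw [add_zero]
      rcases ht k hk h with h | ⟨h1, h2⟩
      · exact hlong k hk h
      · exact hshort k h1 h2
  calc (f S.N)⁻¹ * ∑ i, ‖proj (S.E i) (∑ k ∈ Finset.range N, u k)‖
      ≤ (f S.N)⁻¹ * ∑ i, ∑ k ∈ Finset.range N, ‖proj (S.E i) (u k)‖ := by
        gcongr
        rw [map_sum]
        exact norm_sum_le _ _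
    _ = ∑ k ∈ Finset.range N, (f S.N)⁻¹ * ∑ i, ‖proj (S.E i) (u k)‖ := by
        rw [Finset.sum_comm, Finset.mul_sum]
    _ ≤ ∑ k ∈ Finset.range N, (c + if k = t then 1 else 0) := Finset.sum_le_sum hterm
    _ ≤ 1 + N * c := by
        rw [Finset.sum_add_distrib, Finset.sum_const, nsmul_eq_mul, Finset.card_range,
          Finset.sum_ite_eq']
        split_ifs <;> linarith

/-- A sum over many successive sets is almost attained on one vector of the R.I.S. -/
theorem RIS_term_le_of_long (hε : 0 < ε)
    (havg : ∀ k < N, IsAverage (n k) (1 + ε) (u k))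
    (hcard : ∀ k, k + 1 < N →
      ((supp (u k)).card : ℝ) ≤ min ε 1 / 2 * Real.sqrt (f (n (k + 1))))
    (hN : 0 < N) {B : ℝ} (hB : 1 ≤ B) (S : SuccessiveSets) (hS : 36 * (N * B) ^ 2 ≤ f S.N) :
    (f S.N)⁻¹ * ∑ i, ‖proj (S.E i) (∑ k ∈ Finset.range N, u k)‖ ≤
      1 + (min ε 1 / 12 + (1 + ε) / (18 * B)) := by
  refine (RIS_term_le hε havg hcard S).trans ?_
  have hη : 0 < min ε 1 := lt_min hε one_pos
  have hf : 0 < f S.N := zero_lt_one.trans_le (one_le_f_N S)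
  have hN' : (1 : ℝ) ≤ N := by exact_mod_cast hN
  have hs : 6 * (N * B) ≤ Real.sqrt (f S.N) :=
    Real.le_sqrt_of_sq_le (by nlinarith)
  have hNB : 0 < 6 * (N * B) := by positivity
  rw [mul_add]
  have h1 : N * (min ε 1 / 2 / Real.sqrt (f S.N)) ≤ min ε 1 / 12 := by
    calc N * (min ε 1 / 2 / Real.sqrt (f S.N)) ≤ N * (min ε 1 / 2 / (6 * (N * B))) := by gcongr
      _ = min ε 1 / 12 / B := by field_simp; ring
      _ ≤ min ε 1 / 12 := div_le_self (by positivity) hB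
  have h2 : N * (2 * (1 + ε) / f S.N) ≤ (1 + ε) / (18 * B) := by
    calc N * (2 * (1 + ε) / f S.N) ≤ N * (2 * (1 + ε) / (36 * (N * B) ^ 2)) := by gcongr
      _ = (1 + ε) / (18 * B) / (N * B) := by field_simp; ring
      _ ≤ (1 + ε) / (18 * B) := div_le_self (by positivity) (by nlinarith)
  linarith

end RIS

/-- Intersection of all sets with a fixed one. -/
def SuccessiveSets.inter (S : SuccessiveSets) (E : Finset ℕ) : SuccessiveSets where
  N := S.N
  two_le := S.two_le
  E i := S.E i ∩ E
  lt i j hij a ha b hb :=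
    S.lt i j hij a (Finset.mem_inter.1 ha).1 b (Finset.mem_inter.1 hb).1

/-! ### Successive small vectors laid out as intervals `[p i, p i + w i]` on the line -/

section Pieces

variable {ι : Type*} {s : Finset ι} {y : ι → C00} {p w : ι → ℝ} {C η w₀ c : ℝ}

/-- This is the triangle inequality: the intervals of the pieces met by `E` do not overlap and lie
in `[a, b + w₀]`. The extra `w₀` accounts for the last piece, of which only the starting point is
known to be at most `b`. -/
theorem norm_proj_sum_le_length
    (hC : 0 ≤ C) (hw : ∀ i ∈ s, 0 ≤ w i) (hw₀ : ∀ i ∈ s, w i ≤ w₀) (hw₀' : 0 ≤ w₀)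
    (hy : ∀ i ∈ s, ‖y i‖ ≤ C * w i)
    (hord : ∀ i ∈ s, ∀ j ∈ s, i ≠ j →
      (p i + w i ≤ p j ∧ ∀ a ∈ supp (y i), ∀ b ∈ supp (y j), a < b) ∨
      (p j + w j ≤ p i ∧ ∀ a ∈ supp (y j), ∀ b ∈ supp (y i), a < b))
    (E : Finset ℕ) (a b : ℝ) (hab : a ≤ b)
    (hE : ∀ i ∈ s, (∃ t ∈ E, t ∈ supp (y i)) → a ≤ p i ∧ p i ≤ b) :
    ‖proj E (∑ i ∈ s, y i)‖ ≤ C * (b - a + w₀) := by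
  classical
  let T := s.filter fun i => ∃ t ∈ E, t ∈ supp (y i)
  have hT : ∀ i ∈ T, i ∈ s ∧ a ≤ p i ∧ p i ≤ b := fun i hi => by
    obtain ⟨h1, h2⟩ := Finset.mem_filter.1 hi
    exact ⟨h1, hE i h1 h2⟩
  calc ‖proj E (∑ i ∈ s, y i)‖ ≤ ∑ i ∈ s, ‖proj E (y i)‖ := by
        rw [map_sum]
        exact norm_sum_le _ _
    _ = ∑ i ∈ T, ‖proj E (y i)‖ := by
        refine (Finset.sum_filter_of_ne fun q _ hq => ?_).symm
        by_contra h
        push Not at h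
        exact hq (by rw [proj_eq_zero h, norm_zero])
    _ ≤ ∑ i ∈ T, C * w i :=
        Finset.sum_le_sum fun i hi => (norm_proj_le _ _).trans (hy i (hT i hi).1)
    _ = C * ∑ i ∈ T, ((p i + w i) - p i) := by
        rw [Finset.mul_sum]
        exact Finset.sum_congr rfl fun i _ => by ring
    _ ≤ C * (b + w₀ - a) := by
        refine mul_le_mul_of_nonneg_left (sum_length_le T _ _ a (b + w₀) (by linarith)
          (fun i hi => ?_) (fun i hi => (hT i hi).2.1) (fun i hi => ?_)
          fun i hi j hj hij => ?_) hC
        · linarith [hw i (hT i hi).1]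
        · linarith [hw₀ i (hT i hi).1, (hT i hi).2.2]
        · exact (hord i (hT i hi).1 j (hT j hj).1 hij).imp And.left And.left
    _ = C * (b - a + w₀) := by ring

/-- The sets of a successive sequence whose lengths are not negligible, and these lengths. -/
theorem exists_lengths {K l : ℝ} (hK : 0 ≤ K) (hl0 : 0 ≤ l) (hw : ∀ i ∈ s, 0 ≤ w i)
    (hord : ∀ i ∈ s, ∀ j ∈ s, i ≠ j →
      (p i + w i ≤ p j ∧ ∀ a ∈ supp (y i), ∀ b ∈ supp (y j), a < b) ∨
      (p j + w j ≤ p i ∧ ∀ a ∈ supp (y j), ∀ b ∈ supp (y i), a < b))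
    (S : SuccessiveSets) (a b : ℝ) (hab : a ≤ b)
    (hE : ∀ i, ∀ k ∈ s, (∃ t ∈ S.E i, t ∈ supp (y k)) → a ≤ p k ∧ p k ≤ b)
    (hS : ∀ i, ∀ a b : ℝ, a ≤ b →
      (∀ k ∈ s, (∃ t ∈ S.E i, t ∈ supp (y k)) → a ≤ p k ∧ p k ≤ b) →
      ‖proj (S.E i) (∑ i ∈ s, y i)‖ ≤ K * max l (divF (b - a))) :
    ∃ (big : Finset (Fin S.N)) (L : Fin S.N → ℝ), (∀ i ∈ big, 0 < L i) ∧
      ∑ i ∈ big, L i ≤ b - a ∧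
      ∑ i, ‖proj (S.E i) (∑ i ∈ s, y i)‖ ≤
        K * (((S.N : ℝ) - big.card) * l + ∑ i ∈ big, divF (L i)) := by
  classical
  -- The interval of a set runs from the first to the last starting point of the pieces that it
  -- meets. A set that meets one piece only gets length zero, so a piece cut by several sets is not
  -- counted more than once.
  have hint : ∀ i : Fin S.N, ∃ q : ℝ × ℝ, q.1 ≤ q.2 ∧
      (∀ k ∈ s, (∃ t ∈ S.E i, t ∈ supp (y k)) → q.1 ≤ p k ∧ p k ≤ q.2) ∧
      (q.1 < q.2 → (∃ k ∈ s, (∃ t ∈ S.E i, t ∈ supp (y k)) ∧ p k = q.1) ∧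
        (∃ k ∈ s, (∃ t ∈ S.E i, t ∈ supp (y k)) ∧ p k = q.2)) := by
    intro i
    by_cases hne : (s.filter fun k => ∃ t ∈ S.E i, t ∈ supp (y k)).Nonempty
    · obtain ⟨k, hk, hkmin⟩ := Finset.exists_min_image _ p hne
      obtain ⟨k', hk', hkmax⟩ := Finset.exists_max_image _ p hne
      have h3 := Finset.mem_filter.1 hk
      have h4 := Finset.mem_filter.1 hk'
      refine ⟨(p k, p k'), hkmin k' hk', fun r hr hr' => ?_, fun _ =>
        ⟨⟨k, h3.1, h3.2, rfl⟩, ⟨k', h4.1, h4.2, rfl⟩⟩⟩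
      exact ⟨hkmin r (Finset.mem_filter.2 ⟨hr, hr'⟩), hkmax r (Finset.mem_filter.2 ⟨hr, hr'⟩)⟩
    · refine ⟨(0, 0), le_rfl, fun k hk hk' => ?_, fun h => absurd h (lt_irrefl _)⟩
      exact absurd ⟨k, Finset.mem_filter.2 ⟨hk, hk'⟩⟩ hne
  choose q hq hqb hqe using hint
  have hIH : ∀ i, ‖proj (S.E i) (∑ i ∈ s, y i)‖ ≤ K * max l (divF ((q i).2 - (q i).1)) :=
    fun i => hS i _ _ (hq i) (hqb i)
  let big := Finset.univ.filter fun i : Fin S.N => l < divF ((q i).2 - (q i).1)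
  have hbig : ∀ i ∈ big, (q i).1 < (q i).2 := by
    intro i hi
    have h3 := (Finset.mem_filter.1 hi).2
    refine lt_of_le_of_ne (hq i) fun h => ?_
    rw [← h, sub_self, divF_of_le_one le_rfl zero_le_one] at h3
    linarith
  have hlt : ∀ i ∈ big, ∀ j ∈ big, i < j → (q i).2 ≤ (q j).1 := by
    intro i hi j hj hij
    obtain ⟨-, k, hk, ⟨t, ht, ht'⟩, hkq⟩ := hqe i (hbig i hi)
    obtain ⟨⟨k', hk', ⟨t', ht1, ht1'⟩, hkq'⟩, -⟩ := hqe j (hbig j hj)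
    rw [← hkq, ← hkq']
    -- If the last piece of one set is also the first piece of a later one, their intervals merely
    -- touch.
    by_cases hkk : k = k'
    · rw [hkk]
    rcases hord k hk k' hk' hkk with h | h
    · linarith [hw k hk, h.1]
    · have h3 := h.2 t' ht1' t ht'
      have h4 := S.lt i j hij t ht t' ht1
      omega
  have hsum : ∑ i ∈ big, ((q i).2 - (q i).1) ≤ b - a := by
    refine sum_length_le big _ _ a b hab (fun i _ => hq i) (fun i hi => ?_) (fun i hi => ?_)
      fun i hi j hj hij => ?_
    · obtain ⟨⟨k, hk, hk', hkq⟩, -⟩ := hqe i (hbig i hi)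
      rw [← hkq]
      exact (hE i k hk hk').1
    · obtain ⟨-, k, hk, hk', hkq⟩ := hqe i (hbig i hi)
      rw [← hkq]
      exact (hE i k hk hk').2
    · rcases lt_or_gt_of_ne hij with h | h
      · exact Or.inl (hlt i hi j hj h)
      · exact Or.inr (hlt j hj i hi h)
  have hmax : ∑ i, max l (divF ((q i).2 - (q i).1)) ≤
      ((S.N : ℝ) - big.card) * l + ∑ i ∈ big, divF ((q i).2 - (q i).1) := by
    rw [← Finset.sum_filter_add_sum_filter_not Finset.univ
      (fun i : Fin S.N => l < divF ((q i).2 - (q i).1)), add_comm]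
    refine add_le_add (le_of_eq ?_) (le_of_eq ?_)
    · rw [Finset.sum_congr rfl (g := fun _ => l), Finset.sum_const, nsmul_eq_mul]
      · congr 1
        rw [eq_sub_iff_add_eq, add_comm]
        have := Finset.card_filter_add_card_filter_not (s := (Finset.univ : Finset (Fin S.N)))
          (fun i : Fin S.N => l < divF ((q i).2 - (q i).1))
        rw [Finset.card_univ, Fintype.card_fin] at this
        exact_mod_cast this
      · intro i hi
        exact max_eq_left (not_lt.1 (Finset.mem_filter.1 hi).2)
    · exact Finset.sum_congr rfl fun i hi => max_eq_right (Finset.mem_filter.1 hi).2.le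
  refine ⟨big, fun i => (q i).2 - (q i).1, fun i hi => sub_pos.2 (hbig i hi), hsum, ?_⟩
  refine (Finset.sum_le_sum fun i _ => hIH i).trans ?_
  rw [← Finset.mul_sum]
  exact mul_le_mul_of_nonneg_left hmax hK

/-- The main estimate: the norm of a piece of a long sum is controlled by `divF` of its length. -/
theorem norm_proj_sum_le_divF
    (hC : 0 ≤ C) (hη : 0 < η) (hCη : 1 ≤ C + η)
    (hw : ∀ i ∈ s, 0 ≤ w i) (hw₀ : ∀ i ∈ s, w i ≤ w₀) (hw₀' : 0 ≤ w₀)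
    (hy : ∀ i ∈ s, ‖y i‖ ≤ C * w i)
    (hord : ∀ i ∈ s, ∀ j ∈ s, i ≠ j →
      (p i + w i ≤ p j ∧ ∀ a ∈ supp (y i), ∀ b ∈ supp (y j), a < b) ∨
      (p j + w j ≤ p i ∧ ∀ a ∈ supp (y j), ∀ b ∈ supp (y i), a < b))
    (hcoord : ∀ a, |(∑ i ∈ s, y i).coord a| ≤ 1)
    (hS : ∀ S : SuccessiveSets,
      (f S.N)⁻¹ * ∑ i, ‖proj (S.E i) (∑ i ∈ s, y i)‖ ≤ C + η ∨ (S.N : ℝ) + 1 ≤ c)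
    (hl : C * w₀ / η * (c * Real.log 2) ≤ 1)
    (E : Finset ℕ) (a b : ℝ) (hab : a ≤ b)
    (hE : ∀ i ∈ s, (∃ t ∈ E, t ∈ supp (y i)) → a ≤ p i ∧ p i ≤ b) :
    ‖proj E (∑ i ∈ s, y i)‖ ≤ (C + η) * max (C * w₀ / η) (divF (b - a)) := by
  classical
  set x := ∑ i ∈ s, y i with hx
  set l := C * w₀ / η with hl'
  have hl0 : 0 ≤ l := by positivity
  have hK : 0 ≤ C + η := by positivity
  obtain ⟨m, hm⟩ : ∃ m, m = (supp (proj E x)).card := ⟨_, rfl⟩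
  induction m using Nat.strong_induction_on generalizing E a b with
  | _ m ih =>
  rcases le_or_gt (b - a) 1 with h1 | h1
  · rw [divF_of_le_one (by linarith) h1]
    refine (norm_proj_sum_le_length hC hw hw₀ hw₀' hy hord E a b hab hE).trans ?_
    -- The threshold `l` is chosen so that the boundary error `C * w₀` of the length estimate is
    -- absorbed by the `η` in `C + η`.
    have h2 : C * w₀ = η * l := by
      rw [hl']
      field_simp
    calc C * (b - a + w₀) = C * (b - a) + η * l := by rw [← h2]; ring
      _ ≤ C * max l (b - a) + η * max l (b - a) := by
          gcongr
          · exact le_max_right _ _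
          · exact le_max_left _ _
      _ = _ := by ring
  have hG : 1 ≤ divF (b - a) := one_le_divF h1.le
  have hG' : (C + η) ≤ (C + η) * max l (divF (b - a)) :=
    le_mul_of_one_le_right hK (hG.trans (le_max_right _ _))
  refine norm_le_of (fun t => ?_) fun S hcard => ?_
  · refine le_trans ?_ (hCη.trans hG')
    rw [coord_proj]
    split_ifs
    · exact hcoord t
    · simp
  · have hpp : ∀ i, proj (S.E i) (proj E x) = proj (S.E i ∩ E) x := fun i => proj_proj _ _ _
    simp only [hpp] at hcard ⊢
    -- Many sets are handled directly by the hypothesis. For few sets the induction applies to each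
    -- part, since its support is strictly smaller.
    rcases hS (S.inter E) with h2 | h2
    · exact h2.trans hG'
    change (S.N : ℝ) + 1 ≤ c at h2
    obtain ⟨big, L, hL, hsum, hle⟩ := exists_lengths hK hl0 hw hord (S.inter E) a b hab
      (fun i k hk ⟨t, ht, ht'⟩ => hE k hk ⟨t, (Finset.mem_inter.1 ht).2, ht'⟩)
      (fun i a b hab hE => ih _ (hm ▸ hcard i) _ _ _ hab hE rfl)
    change ∑ i, ‖proj (S.E i ∩ E) x‖ ≤ (C + η) * (((S.N : ℝ) - big.card) * l + _) at hle
    have hG1 := sum_divF_le_f_mul big L hL hsum h1.le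
    have hbc : big.card ≤ S.N := (Finset.card_le_univ big).trans (Fintype.card_fin S.N).le
    have hG2 : ((S.N : ℝ) - big.card) * l ≤ f S.N - f big.card :=
      sub_mul_le_f_sub (by positivity) (by exact_mod_cast hbc) h2 hl
    have hf0 : f big.card ≤ f S.N := f_mono (by positivity) (by exact_mod_cast hbc)
    have hf : 0 < f S.N := zero_lt_one.trans_le (one_le_f_N S)
    -- The negligible sets give at most `f S.N - f big.card` and the others at most `f big.card *
    -- divF (b - a)`. As `divF (b - a) ≥ 1`, the total is at most `f S.N * divF (b - a)`.
    calc (f S.N)⁻¹ * ∑ i, ‖proj (S.E i ∩ E) x‖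
        ≤ (f S.N)⁻¹ * ((C + η) * (f S.N * divF (b - a))) := by
          gcongr
          refine hle.trans ?_
          gcongr
          nlinarith
      _ = (C + η) * divF (b - a) := by
          field_simp
      _ ≤ _ := by
          gcongr
          exact le_max_right _ _

end Pieces

/-! ### Upper estimates for sums of a R.I.S. -/

theorem Mf_nonneg (x : ℝ) : 0 ≤ Mf x := by
  unfold Mf
  rw [sub_nonneg]
  exact Real.one_le_rpow (by norm_num) (by positivity)

theorem self_le_Mf {x : ℝ} (hx : 1 ≤ x) : x ^ 2 ≤ Mf x := by
  unfold Mf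
  have h := one_add_mul_self_le_rpow_one_add (show (-1 : ℝ) ≤ 1 by norm_num)
    (show 1 ≤ 36 * x ^ 2 by nlinarith)
  norm_num at h ⊢
  nlinarith

/-- The `k`-th average fills `[k, k + 1]` with `n k` equal intervals, so the whole sum has length
`N`. The second estimate is for projections onto at most `N` sets: the non-negligible ones share the
length `N`, and concavity of `divF` makes equal shares the worst case. -/
theorem IsRIS.norm_estimates {N : ℕ} {ε : ℝ} {u : ℕ → C00} (hε : 0 < ε) (hN : 0 < N)
    (hu : IsRIS N ε u) :
    ‖∑ k ∈ Finset.range N, u k‖ ≤ (1 + ε + min ε 1) * (N / f N) ∧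
    ∀ S : SuccessiveSets, S.N ≤ N → ∑ i, ‖proj (S.E i) (∑ k ∈ Finset.range N, u k)‖ ≤
      (1 + ε + min ε 1) * (1 + N / f (N / S.N)) := by
  obtain ⟨hsucc, n, havg, hn0, hcard⟩ := hu
  have hmono := RIS_monotone havg hcard
  have hη : 0 < min ε 1 := lt_min hε one_pos
  have hη1 : min ε 1 ≤ 1 := min_le_right _ _
  have hηε : min ε 1 ≤ ε := min_le_left _ _
  have hlong := fun B hB S => RIS_term_le_of_long hε havg hcard hN (B := B) hB S
  set η := min ε 1 with hη'
  have hN' : (1 : ℝ) ≤ N := by exact_mod_cast hN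
  have hl2 : 0 < Real.log 2 := Real.log_pos (by norm_num)
  have hl2' : 1 / 2 ≤ Real.log 2 := by linarith [Real.log_two_gt_d9]
  have hnη : 1 ≤ N / η := (one_le_div hη).2 (hη1.trans hN')
  have hMfN : N ≤ Mf (N / η) := by
    refine le_trans ?_ (self_le_Mf hnη)
    have : (N : ℝ) ≤ N / η := by
      rw [le_div_iff₀ hη]
      nlinarith
    nlinarith
  have hnpos : ∀ k < N, (0 : ℝ) < n k := fun k hk => by exact_mod_cast (havg k hk).pos
  -- Since `f'(1) = 1 / (2 * log 2)`, this is precisely the lower bound on `n 0` in the definition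
  -- of a R.I.S.; it fixes the threshold `4 * Mf (N / η)` between few and many sets.
  have hl : (1 + ε) * (n 0 : ℝ)⁻¹ / η * (4 * Mf (N / η) * Real.log 2) ≤ 1 := by
    have h0 := hnpos 0 hN
    rw [fDerivOne_eq, div_le_iff₀ (by positivity)] at hn0
    have h1 : 2 * (1 + ε) * Mf (N / η) * (2 * Real.log 2) ≤ n 0 * η := by
      have := mul_le_mul_of_nonneg_right hn0 (show 0 ≤ 2 * Real.log 2 by positivity)
      field_simp at this
      linarith
    have h2 : (1 + ε) * (n 0 : ℝ)⁻¹ / η * (4 * Mf (N / η) * Real.log 2) =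
        2 * (1 + ε) * Mf (N / η) * (2 * Real.log 2) / (n 0 * η) := by
      field_simp
      ring
    rw [h2, div_le_one (by positivity)]
    exact h1
  set l := (1 + ε) * (n 0 : ℝ)⁻¹ / η with hl'
  have hl0 : 0 ≤ l := by positivity
  have hNl : N * l ≤ 1 := by
    have : l * N ≤ l * (4 * Mf (N / η) * Real.log 2) := by
      gcongr
      nlinarith
    linarith
  have hY : ∀ k, ∃ y : ℕ → C00, k < N → SuccessiveVectors (n k) y ∧
      u k = ∑ i ∈ Finset.range (n k), y i ∧ ∀ i < n k, ‖y i‖ ≤ (1 + ε) * (n k : ℝ)⁻¹ := by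
    intro k
    by_cases hk : k < N
    · obtain ⟨-, y, -, h⟩ := havg k hk
      exact ⟨y, fun _ => h⟩
    · exact ⟨0, fun h => absurd h hk⟩
  choose Y hY using hY
  let s : Finset (Σ _ : ℕ, ℕ) := (Finset.range N).sigma fun k => Finset.range (n k)
  let y : (Σ _ : ℕ, ℕ) → C00 := fun q => Y q.1 q.2
  let p : (Σ _ : ℕ, ℕ) → ℝ := fun q => q.1 + q.2 * (n q.1 : ℝ)⁻¹
  let w : (Σ _ : ℕ, ℕ) → ℝ := fun q => (n q.1 : ℝ)⁻¹
  have hs : ∀ q ∈ s, q.1 < N ∧ q.2 < n q.1 := fun q hq => by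
    simpa [s] using hq
  have hsum : ∑ q ∈ s, y q = ∑ k ∈ Finset.range N, u k := by
    rw [Finset.sum_sigma]
    exact Finset.sum_congr rfl fun k hk => ((hY k (Finset.mem_range.1 hk)).2.1).symm
  have hw : ∀ q ∈ s, 0 ≤ w q := fun q _ => by positivity
  have hw₀ : ∀ q ∈ s, w q ≤ (n 0 : ℝ)⁻¹ := fun q hq => by
    have h0 := hnpos 0 hN
    exact inv_anti₀ h0 (by exact_mod_cast hmono 0 q.1 (Nat.zero_le _) (hs q hq).1)
  have hy : ∀ q ∈ s, ‖y q‖ ≤ (1 + ε) * w q := fun q hq =>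
    (hY q.1 (hs q hq).1).2.2 q.2 (hs q hq).2
  have hp : ∀ q ∈ s, 0 ≤ p q ∧ p q + w q ≤ q.1 + 1 := fun q hq => by
    have h0 := hnpos q.1 (hs q hq).1
    have h1 : (q.2 : ℝ) + 1 ≤ n q.1 := by exact_mod_cast (hs q hq).2
    refine ⟨by positivity, ?_⟩
    have h2 : ((q.2 : ℝ) + 1) * (n q.1 : ℝ)⁻¹ ≤ 1 := by
      rw [← div_eq_mul_inv]
      exact (div_le_one h0).2 h1
    simp only [p, w]
    linarith
  have hsub : ∀ q ∈ s, supp (y q) ⊆ supp (u q.1) := fun q hq => by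
    rw [(hY q.1 (hs q hq).1).2.1]
    exact (hY q.1 (hs q hq).1).1.supp_subset (hs q hq).2
  have hlt : ∀ q ∈ s, ∀ q' ∈ s, (q.1 < q'.1 ∨ q.1 = q'.1 ∧ q.2 < q'.2) →
      (p q + w q ≤ p q' ∧ ∀ a ∈ supp (y q), ∀ b ∈ supp (y q'), a < b) := by
    rintro q hq q' hq' (h | h)
    · refine ⟨?_, fun a ha b hb => hsucc.lt_of h (hs q' hq').1 (hsub q hq ha) (hsub q' hq' hb)⟩
      refine (hp q hq).2.trans ?_
      have h1 : (q.1 : ℝ) + 1 ≤ q'.1 := by exact_mod_cast h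
      refine h1.trans ?_
      simp only [p]
      have : 0 ≤ (q'.2 : ℝ) * (n q'.1 : ℝ)⁻¹ := by positivity
      linarith
    · obtain ⟨k, r⟩ := q
      obtain ⟨k', r'⟩ := q'
      obtain ⟨h1, h2⟩ := h
      simp only at h1 h2
      subst h1
      refine ⟨?_, fun a ha b hb => (hY k (hs _ hq).1).1.lt_of h2 (hs _ hq').2 ha hb⟩
      simp only [p, w]
      have h3 : (r : ℝ) + 1 ≤ r' := by exact_mod_cast h2
      have h4 : 0 ≤ (n k : ℝ)⁻¹ := by positivity
      nlinarith
  have hord : ∀ i ∈ s, ∀ j ∈ s, i ≠ j →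
      (p i + w i ≤ p j ∧ ∀ a ∈ supp (y i), ∀ b ∈ supp (y j), a < b) ∨
      (p j + w j ≤ p i ∧ ∀ a ∈ supp (y j), ∀ b ∈ supp (y i), a < b) := by
    rintro ⟨k, r⟩ hq ⟨k', r'⟩ hq' hne
    rcases lt_trichotomy k k' with h | h | h
    · exact Or.inl (hlt _ hq _ hq' (Or.inl h))
    · subst h
      rcases lt_trichotomy r r' with h' | h' | h'
      · exact Or.inl (hlt _ hq _ hq' (Or.inr ⟨rfl, h'⟩))
      · exact absurd (by rw [h']) hne
      · exact Or.inr (hlt _ hq' _ hq (Or.inr ⟨rfl, h'⟩))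
    · exact Or.inr (hlt _ hq' _ hq (Or.inl h))
  have hcoord : ∀ a, |(∑ i ∈ s, y i).coord a| ≤ 1 := by
    intro a
    rw [hsum]
    by_cases ha : a ∈ supp (∑ k ∈ Finset.range N, u k)
    · obtain ⟨k, hk, hka⟩ := exists_mem_supp_of_mem_sum ha
      rw [hsucc.coord_sum (Finset.mem_range.1 hk) hka]
      exact (abs_coord_le _ _).trans (havg k (Finset.mem_range.1 hk)).1.le
    · rw [mem_supp, not_not] at ha
      simp [ha]
  -- With `B = 1 / η` the condition for many sets is `f (Mf (N / η)) ≤ f S.N`. Its failure means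
  -- `S.N < Mf (N / η)`, and `Mf (N / η) ≥ 1` leaves room for the added `1`.
  have hS : ∀ S : SuccessiveSets,
      (f S.N)⁻¹ * ∑ i, ‖proj (S.E i) (∑ i ∈ s, y i)‖ ≤ 1 + ε + η ∨
        (S.N : ℝ) + 1 ≤ 4 * Mf (N / η) := by
    intro S
    rcases le_or_gt (36 * (N * (1 / η)) ^ 2) (f S.N) with h | h
    · left
      rw [hsum]
      refine (hlong (1 / η) ((one_le_div hη).2 hη1) S h).trans ?_
      have h1 : (1 + ε) / (18 * (1 / η)) = (η + ε * η) / 18 := by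
        field_simp
      rw [h1]
      nlinarith
    · right
      have h1 : (S.N : ℝ) < Mf (N / η) := by
        by_contra h2
        have := f_mono (Mf_nonneg _) (not_lt.1 h2)
        rw [f_Mf] at this
        rw [mul_one_div] at h
        linarith
      linarith
  have hmain := norm_proj_sum_le_divF (C := 1 + ε) (η := η) (by positivity) hη (by linarith) hw hw₀
    (by positivity) hy hord hcoord hS hl
  rw [hsum] at hmain
  have hrange : ∀ q ∈ s, (0 : ℝ) ≤ p q ∧ p q ≤ N := fun q hq => by
    refine ⟨(hp q hq).1, ?_⟩
    have h1 := (hp q hq).2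
    have h2 := hw q hq
    have h3 : (q.1 : ℝ) + 1 ≤ N := by exact_mod_cast (hs q hq).1
    linarith
  constructor
  · have h := hmain (supp (∑ k ∈ Finset.range N, u k)) 0 N (by positivity)
      fun q hq _ => hrange q hq
    rw [proj_eq_self subset_rfl, sub_zero, max_eq_right, divF_of_one_le hN'] at h
    · exact h
    · refine le_trans ?_ (one_le_divF hN')
      nlinarith
  · intro S hSN
    obtain ⟨big, L, hL, hLsum, hle⟩ := exists_lengths (K := 1 + ε + η) (l := l) (by positivity) hl0
      hw hord S 0 N (by positivity) (fun i k hk _ => hrange k hk)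
      (by rw [hsum]; exact fun i => hmain (S.E i))
    rw [hsum, sub_zero] at *
    refine hle.trans ?_
    have hSN' : (S.N : ℝ) ≤ N := by exact_mod_cast hSN
    have hS0 : (0 : ℝ) < S.N := by
      have := S.two_le
      exact_mod_cast (by omega : 0 < S.N)
    gcongr
    -- All negligible sets together contribute at most `N * l ≤ 1`, the source of the summand `1`.
    · have h1 : (0 : ℝ) ≤ big.card := by positivity
      have h2 : ((S.N : ℝ) - big.card) * l ≤ N * l := by
        gcongr
        linarith
      linarith
    · rcases big.eq_empty_or_nonempty with h | h
      · rw [h, Finset.sum_empty]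
        exact div_nonneg (by positivity) (f_nonneg (by positivity))
      · refine (sum_divF_le_of_le big h L hL hLsum).trans ?_
        have hb0 : (0 : ℝ) < big.card := by exact_mod_cast h.card_pos
        have hbS : (big.card : ℝ) ≤ S.N := by
          have : big.card ≤ S.N := by simpa using Finset.card_le_univ big
          exact_mod_cast this
        have h1 : 1 ≤ (N : ℝ) / S.N := (one_le_div hS0).2 hSN'
        have h2 : (N : ℝ) / S.N ≤ N / big.card := by gcongr
        rw [divF_of_one_le (h1.trans h2)]
        have h3 : (big.card : ℝ) * (N / big.card / f (N / big.card)) = N / f (N / big.card) := by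
          field_simp
        rw [h3]
        have h4 := f_mono (by linarith) h2
        have h5 := f_pos h1
        gcongr

end Schlumprecht

/-- An infinite-dimensional subspace contains a non-zero vector at which finitely many given
functionals vanish. -/
theorem exists_mem_ne_zero_of_not_finiteDimensional {X : Type*} [AddCommGroup X] [Module ℝ X]
    {Y : Submodule ℝ X} (hY : ¬ FiniteDimensional ℝ Y) {m : ℕ} (T : X →ₗ[ℝ] (Fin m → ℝ)) :
    ∃ y ∈ Y, y ≠ 0 ∧ T y = 0 := by
  by_contra! h
  refine hY (FiniteDimensional.of_injective (T.comp Y.subtype) ?_)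
  rw [← LinearMap.ker_eq_bot, LinearMap.ker_eq_bot']
  intro y hy
  by_contra hne
  exact h y y.2 (fun h0 => hne (Subtype.ext h0)) hy

namespace Schlumprecht
open C00

/-! ## Existence of averages and of rapidly increasing sequences -/

/-- Greedy choice: the state is the last vector together with a bound beyond the supports so far.
The relation `P` may look at the previous vector, as the growth condition of a R.I.S. requires. -/
theorem exists_successive (P : ℕ → C00 → C00 → Prop) (m₀ : ℕ)
    (h : ∀ (j : ℕ) (x : C00) (m : ℕ), ∃ v, P j x v ∧ ∀ a ∈ supp v, m ≤ a) :
    ∃ v : ℕ → C00, P 0 0 (v 0) ∧ (∀ j, P (j + 1) (v j) (v (j + 1))) ∧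
      (∀ i j, i < j → ∀ a ∈ supp (v i), ∀ b ∈ supp (v j), a < b) ∧
      ∀ j, ∀ a ∈ supp (v j), m₀ ≤ a := by
  choose g hg hgm using h
  let s : ℕ → C00 × ℕ := fun j => Nat.rec (0, m₀)
    (fun j q => (g j q.1 q.2, max q.2 ((supp (g j q.1 q.2)).sup id + 1))) j
  have hs : ∀ j, s (j + 1) =
      (g j (s j).1 (s j).2, max (s j).2 ((supp (g j (s j).1 (s j).2)).sup id + 1)) :=
    fun _ => rfl
  have hmono : Monotone fun j => (s j).2 := monotone_nat_of_le_succ fun j => by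
    rw [hs]
    exact le_max_left _ _
  have hv : ∀ j, (s (j + 1)).1 = g j (s j).1 (s j).2 := fun j => by rw [hs]
  refine ⟨fun j => (s (j + 1)).1, ?_, fun j => ?_, fun i j hij a ha b hb => ?_, fun j a ha => ?_⟩
  · simp only [hv]
    exact hg 0 _ _
  · simp only [hv (j + 1)]
    exact hg (j + 1) _ _
  · simp only [hv] at ha hb
    have h1 := hgm _ _ _ b hb
    have h2 : a < (s (i + 1)).2 := by
      rw [hs]
      exact lt_max_of_lt_right (Nat.lt_succ_of_le (Finset.le_sup (f := id) ha))
    exact h2.trans_le ((hmono hij).trans h1)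
  · simp only [hv] at ha
    exact (hmono (Nat.zero_le j)).trans (hgm _ _ _ a ha)

theorem exists_mem_norm_one {Y : Submodule ℝ C00} (hY : ¬ FiniteDimensional ℝ Y) (m : ℕ) :
    ∃ y ∈ Y, ‖y‖ = 1 ∧ ∀ a ∈ supp y, m ≤ a := by
  obtain ⟨y, hy, h0, hT⟩ := exists_mem_ne_zero_of_not_finiteDimensional hY (m := m)
    (LinearMap.pi fun i => (Finsupp.lapply (i : ℕ)).comp C00.toFinsupp.toLinearMap)
  refine ⟨‖y‖⁻¹ • y, Y.smul_mem _ hy, norm_smul_inv_norm h0, fun a ha => ?_⟩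
  by_contra hlt
  have h1 : y.coord a = 0 := congrFun hT ⟨a, not_le.1 hlt⟩
  rw [mem_supp, coord_smul, h1, mul_zero] at ha
  exact ha rfl

theorem sum_blocks {M : Type*} [AddCommMonoid M] (v : ℕ → M) (c q n : ℕ) :
    ∑ r ∈ Finset.range n, ∑ t ∈ Finset.Ico ((c + r) * q) ((c + r + 1) * q), v t =
      ∑ t ∈ Finset.Ico (c * q) ((c + n) * q), v t := by
  induction n with
  | zero => simp
  | succ n ih =>
    rw [Finset.sum_range_succ, ih, Finset.sum_Ico_consecutive _
      (Nat.mul_le_mul_right _ (by omega)) (Nat.mul_le_mul_right _ (by omega))]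
    rfl

theorem coord_sum_of_successive {v : ℕ → C00}
    (hv : ∀ i j, i < j → ∀ a ∈ supp (v i), ∀ b ∈ supp (v j), a < b) {s : Finset ℕ} {i a : ℕ}
    (hi : i ∈ s) (ha : a ∈ supp (v i)) : (∑ j ∈ s, v j).coord a = (v i).coord a := by
  rw [C00.coord_sum, Finset.sum_eq_single i]
  · intro j hj hji
    by_contra h
    rcases lt_or_gt_of_ne hji with h' | h'
    · exact lt_irrefl _ (hv j i h' a (mem_supp.2 h) a ha)
    · exact lt_irrefl _ (hv i j h' a ha a (mem_supp.2 h))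
  · exact fun h => absurd hi h

theorem f_pow_le (n k : ℕ) (hn : 1 ≤ n) : f ((n : ℝ) ^ k) ≤ 1 + k * f n := by
  have hn' : (1 : ℝ) ≤ n := by exact_mod_cast hn
  have h2 : (2 : ℝ) ^ f n = n + 1 := by
    unfold f
    exact Real.rpow_logb (by norm_num) (by norm_num) (by linarith)
  rw [f_le_iff (by positivity), Real.rpow_add (by norm_num), Real.rpow_one, mul_comm (k : ℝ),
    Real.rpow_mul (by norm_num), h2, Real.rpow_natCast]
  have h3 : (n : ℝ) ^ k ≤ (n + 1) ^ k := by gcongr; linarith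
  have h4 : (1 : ℝ) ≤ (n + 1) ^ k := one_le_pow₀ (by linarith)
  linarith

/-- A blocking argument. If no block sum is a multiple of an average, then in each group of `n`
consecutive blocks one block has more than `(1 + ε) / n` of the norm of the group. Iterating over
`k` levels, the sum of `n ^ k` unit vectors has norm at most `(n / (1 + ε)) ^ k`. The lower
`f`-estimate then forces `(1 + ε) ^ k ≤ f (n ^ k) ≤ 1 + k * f n` for all `k ≥ 1`, which is false. -/
theorem exists_average {Y : Submodule ℝ C00} (hY : ¬ FiniteDimensional ℝ Y) {ε : ℝ} (hε : 0 < ε)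
    {n : ℕ} (hn : 2 ≤ n) (m : ℕ) :
    ∃ y ∈ Y, IsAverage n (1 + ε) y ∧ ∀ a ∈ supp y, m ≤ a := by
  by_contra! hno
  obtain ⟨v, hv0, hv1, hsucc, hm⟩ := exists_successive (fun _ _ v => v ∈ Y ∧ ‖v‖ = 1) m
    fun _ _ m => by
      obtain ⟨y, h1, h2, h3⟩ := exists_mem_norm_one hY m
      exact ⟨y, ⟨h1, h2⟩, h3⟩
  have hv : ∀ j, v j ∈ Y ∧ ‖v j‖ = 1 := fun j => by
    cases j with
    | zero => exact hv0
    | succ j => exact hv1 j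
  have hn0 : (0 : ℝ) < n := by exact_mod_cast (by omega : 0 < n)
  let B : ℕ → ℕ → C00 := fun i j => ∑ t ∈ Finset.Ico (j * n ^ i) ((j + 1) * n ^ i), v t
  have hBY : ∀ i j, B i j ∈ Y := fun i j => Y.sum_mem fun t _ => (hv t).1
  have hBm : ∀ i j, ∀ a ∈ supp (B i j), m ≤ a := fun i j a ha => by
    obtain ⟨t, -, ht⟩ := exists_mem_supp_of_mem_sum ha
    exact hm t a ht
  have hpow : ∀ i, 0 < n ^ i := fun i => pow_pos (by omega) i
  have hB0 : ∀ i j, B i j ≠ 0 := fun i j h => by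
    have h1 : v (j * n ^ i) ≠ 0 := by
      rw [← norm_ne_zero_iff, (hv _).2]
      exact one_ne_zero
    obtain ⟨a, ha⟩ := supp_nonempty h1
    have h2 := coord_sum_of_successive hsucc (s := Finset.Ico (j * n ^ i) ((j + 1) * n ^ i))
      (Finset.mem_Ico.2 ⟨le_rfl, Nat.mul_lt_mul_of_pos_right (Nat.lt_succ_self j) (hpow i)⟩) ha
    change (B i j).coord a = _ at h2
    rw [h, coord_zero] at h2
    exact mem_supp.1 ha h2.symm
  have hBsucc : ∀ i j j', j < j' → ∀ a ∈ supp (B i j), ∀ b ∈ supp (B i j'), a < b := by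
    intro i j j' hj a ha b hb
    obtain ⟨t, ht, hta⟩ := exists_mem_supp_of_mem_sum ha
    obtain ⟨t', ht', htb⟩ := exists_mem_supp_of_mem_sum hb
    refine hsucc t t' ?_ a hta b htb
    exact ((Finset.mem_Ico.1 ht).2.trans_le (Nat.mul_le_mul_right _ hj)).trans_le
      (Finset.mem_Ico.1 ht').1
  have hrec : ∀ i j, B (i + 1) j = ∑ r ∈ Finset.range n, B i (j * n + r) := fun i j => by
    rw [sum_blocks v (j * n) (n ^ i) n]
    simp only [B]
    congr 2 <;> ring
  have hnorm : ∀ i j, ‖B i j‖ ≤ (n / (1 + ε)) ^ i := by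
    intro i
    induction i with
    | zero =>
      intro j
      simp [B, (hv _).2]
    | succ i ih =>
      intro j
      have hpos : 0 < ‖B (i + 1) j‖ := norm_pos_iff.2 (hB0 _ _)
      have hnot : ¬ IsAverage n (1 + ε) (‖B (i + 1) j‖⁻¹ • B (i + 1) j) := fun h => by
        obtain ⟨a, ha, ham⟩ := hno _ (Y.smul_mem _ (hBY _ _)) h
        exact absurd (hBm _ _ a (supp_smul_subset _ _ ha)) (not_le.2 ham)
      have hex : ∃ r < n, (1 + ε) * (n : ℝ)⁻¹ < ‖B (i + 1) j‖⁻¹ * ‖B i (j * n + r)‖ := by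
        by_contra! hall
        refine hnot ⟨norm_smul_inv_norm (hB0 _ _), fun r => ‖B (i + 1) j‖⁻¹ • B i (j * n + r),
          fun r _ => smul_ne_zero (inv_ne_zero hpos.ne') (hB0 _ _),
          SuccessiveVectors.smul (fun r r' hr _ => hBsucc i _ _ (by omega)) _, ?_, fun r hr => ?_⟩
        · rw [← Finset.smul_sum, ← hrec]
        · rw [norm_smul, norm_inv, norm_norm]
          exact hall r hr
      obtain ⟨r, hr, hlt⟩ := hex
      have h1 : (1 + ε) * (n : ℝ)⁻¹ * ‖B (i + 1) j‖ ≤ (n / (1 + ε)) ^ i := by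
        refine le_trans ?_ (ih (j * n + r))
        rw [lt_inv_mul_iff₀ hpos] at hlt
        linarith
      rw [pow_succ, mul_div_assoc', le_div_iff₀ (by positivity)]
      calc ‖B (i + 1) j‖ * (1 + ε) = (1 + ε) * (n : ℝ)⁻¹ * ‖B (i + 1) j‖ * n := by field_simp
        _ ≤ (n / (1 + ε)) ^ i * n := by gcongr
  have hlow : ∀ k, 1 ≤ k → (1 + ε) ^ k ≤ f ((n : ℝ) ^ k) := by
    intro k hk
    have h2 : 2 ≤ n ^ k := hn.trans (Nat.le_self_pow (by omega) n)
    have h1 := SuccessiveVectors.le_norm_sum (N := n ^ k) (x := v)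
      (fun i j hij _ => hsucc i j hij) h2
    simp only [(hv _).2, Finset.sum_const, Finset.card_range, nsmul_eq_mul, mul_one] at h1
    have h3 := hnorm k 0
    simp only [B, zero_mul, zero_add, one_mul, ← Finset.range_eq_Ico] at h3
    have h4 := h1.trans h3
    push_cast at h4
    have hf : 0 < f ((n : ℝ) ^ k) := f_pos (one_le_pow₀ (by exact_mod_cast (by omega : 1 ≤ n)))
    rw [div_pow, inv_mul_eq_div, div_le_div_iff₀ hf (by positivity)] at h4
    exact le_of_mul_le_mul_left h4 (by positivity)
  have hlim : Tendsto (fun k : ℕ => (1 + k * f n) / (1 + ε) ^ k) atTop (𝓝 0) := by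
    have h1 := tendsto_pow_const_div_const_pow_of_one_lt 0 (show 1 < 1 + ε by linarith)
    have h2 := tendsto_pow_const_div_const_pow_of_one_lt 1 (show 1 < 1 + ε by linarith)
    have h3 := h1.add (h2.mul_const (f n))
    rw [zero_mul, add_zero] at h3
    refine h3.congr fun k => ?_
    rw [pow_zero, pow_one]
    ring
  obtain ⟨k, hk1, hk⟩ := ((eventually_ge_atTop 1).and
    (hlim.eventually (gt_mem_nhds zero_lt_one))).exists
  have h1 := (hlow k hk1).trans (f_pow_le n k (by omega))
  rw [div_lt_one (by positivity)] at hk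
  linarith

theorem tendsto_f : Tendsto (fun n : ℕ => f n) atTop atTop := by
  unfold f
  exact (Real.tendsto_logb_atTop (by norm_num)).comp
    (tendsto_atTop_add_const_right _ _ tendsto_natCast_atTop_atTop)

/-- The length of each average is chosen after the previous support is known. The initial bound `Q`
is imposed on every length, which is harmless and keeps the recursion uniform. -/
theorem exists_isRIS {Y : Submodule ℝ C00} (hY : ¬ FiniteDimensional ℝ Y) {ε : ℝ} (hε : 0 < ε)
    (N : ℕ) : ∃ u : ℕ → C00, IsRIS N ε u ∧ ∀ k, u k ∈ Y := by
  have hη : 0 < min ε 1 := lt_min hε one_pos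
  set Q := 2 * (1 + ε) * Mf (N / min ε 1) / (min ε 1 * fDerivOne) with hQ
  obtain ⟨u, hu0, hu1, hsucc, -⟩ := exists_successive
    (fun _ x v => v ∈ Y ∧ ∃ n : ℕ, IsAverage n (1 + ε) v ∧ Q ≤ n ∧
      ((supp x).card : ℝ) ≤ min ε 1 / 2 * Real.sqrt (f n)) 0 fun _ x m => by
      obtain ⟨n, h2, hQn, hf⟩ := ((eventually_ge_atTop 2).and
        ((tendsto_natCast_atTop_atTop.eventually_ge_atTop Q).and
          (tendsto_f.eventually_ge_atTop ((2 * (supp x).card / min ε 1) ^ 2)))).exists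
      obtain ⟨y, hy, hav, hm⟩ := exists_average hY hε h2 m
      refine ⟨y, ⟨hy, n, hav, hQn, ?_⟩, hm⟩
      have h := Real.le_sqrt_of_sq_le hf
      calc ((supp x).card : ℝ) = min ε 1 / 2 * (2 * (supp x).card / min ε 1) := by field_simp
        _ ≤ _ := by gcongr
  obtain ⟨hu0Y, n₀, h01, h02, -⟩ := hu0
  choose huY n hn1 hn2 hn3 using hu1
  refine ⟨u, ⟨fun i j hij _ => hsucc i j hij, fun k => Nat.casesOn k n₀ n, fun k _ => ?_, h02,
    fun k _ => hn3 k⟩, fun k => ?_⟩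
  · cases k with
    | zero => exact h01
    | succ k => exact hn1 k
  · cases k with
    | zero => exact hu0Y
    | succ k => exact huY k

theorem IsRIS.norm_eq_one {N : ℕ} {ε : ℝ} {u : ℕ → C00} (hu : IsRIS N ε u) {k : ℕ} (hk : k < N) :
    ‖u k‖ = 1 := by
  obtain ⟨-, n, h, -⟩ := hu
  exact (h k hk).1

theorem IsRIS.le_norm_sum {N : ℕ} {ε : ℝ} {u : ℕ → C00} (hu : IsRIS N ε u) (hN : 2 ≤ N) :
    N / f N ≤ ‖∑ k ∈ Finset.range N, u k‖ := by
  refine le_trans (le_of_eq ?_) (hu.1.le_norm_sum hN)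
  rw [Finset.sum_congr rfl fun k hk => hu.norm_eq_one (Finset.mem_range.1 hk)]
  simp [div_eq_inv_mul]

theorem isAsymptoticSet_normalizedRISSums {δ : ℝ} (hδ : 0 < δ) {N : ℕ} (hN : 2 ≤ N) :
    IsAsymptoticSet (normalizedRISSums δ N) := by
  refine ⟨fun x hx => mem_sphere_zero_iff_norm.2 hx.1, fun Y hY => ?_⟩
  obtain ⟨u, hu, huY⟩ := exists_isRIS hY (half_pos hδ) N
  have hN0 : (2 : ℝ) ≤ N := by exact_mod_cast hN
  have h0 : ∑ k ∈ Finset.range N, u k ≠ 0 := norm_pos_iff.1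
    ((div_pos (by linarith) (f_pos (by linarith))).trans_le (hu.le_norm_sum hN))
  refine ⟨‖∑ k ∈ Finset.range N, u k‖⁻¹ • ∑ k ∈ Finset.range N, u k,
    ⟨norm_smul_inv_norm h0, _, u, hu, Finset.smul_sum⟩,
    Y.smul_mem _ (Y.sum_mem fun k _ => huY k)⟩

/-! ## Successive functionals -/

theorem apply_proj_eq (g : C00 →L[ℝ] ℝ) (E : Finset ℕ) (x : C00)
    (h : ∀ a ∈ supp x, g (e a) ≠ 0 → a ∈ E) : g (proj E x) = g x := by
  have h1 : g (x - proj E x) = 0 := by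
    rw [eq_sum (x - proj E x), map_sum]
    refine Finset.sum_eq_zero fun a ha => ?_
    rw [map_smul, smul_eq_mul]
    by_contra hne
    have hg : g (e a) ≠ 0 := right_ne_zero_of_mul hne
    have hx := left_ne_zero_of_mul hne
    rw [coord_sub, coord_proj] at hx
    split_ifs at hx with hE
    · simp at hx
    · exact hE (h a (mem_supp.2 (by simpa using hx)) hg)
  rw [map_sub] at h1
  linarith

/-- Intersecting the supports of the functionals with that of `x` gives finite successive sets, and
`g i` does not see `x` outside its own set. Estimates for sums over sets thus pass to averaged
functionals. -/
theorem SuccessiveFunctionals.exists_sets {N : ℕ} (hN : 2 ≤ N) {g : ℕ → (C00 →L[ℝ] ℝ)}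
    (hg : SuccessiveFunctionals N g) (hg1 : ∀ i < N, ‖g i‖ ≤ 1) (x : C00) :
    ∃ S : SuccessiveSets, S.N = N ∧
      |∑ i ∈ Finset.range N, g i x| ≤ ∑ i, ‖proj (S.E i) x‖ := by
  classical
  refine ⟨⟨N, hN, fun i => (supp x).filter fun a => g i (e a) ≠ 0, fun i j hij a ha b hb =>
    hg i j hij j.2 a (Finset.mem_filter.1 ha).2 b (Finset.mem_filter.1 hb).2⟩, rfl, ?_⟩
  rw [← Fin.sum_univ_eq_sum_range (fun i => g i x)]
  refine (Finset.abs_sum_le_sum_abs _ _).trans (Finset.sum_le_sum fun i _ => ?_)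
  change |g i x| ≤ ‖proj ((supp x).filter fun a => g i (e a) ≠ 0) x‖
  rw [← apply_proj_eq (g i) ((supp x).filter fun a => g i (e a) ≠ 0) x
    fun a ha h => Finset.mem_filter.2 ⟨ha, h⟩]
  exact (g i).le_of_opNorm_le_of_le (hg1 i i.2) le_rfl |>.trans (one_mul _).le

theorem averagedFunctionals_subset {N : ℕ} (hN : 2 ≤ N) :
    averagedFunctionals N ⊆ Metric.closedBall 0 1 := by
  rintro _ ⟨g, hg, hg1, rfl⟩
  rw [mem_closedBall_zero_iff]
  refine ContinuousLinearMap.opNorm_le_bound _ zero_le_one fun x => ?_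
  obtain ⟨S, rfl, hS⟩ := hg.exists_sets hN hg1 x
  rw [one_mul]
  refine le_trans ?_ (sum_norm_proj_le S x)
  have hf := inv_f_nonneg S
  simp only [smul_apply, sum_apply, smul_eq_mul,
    Real.norm_eq_abs, abs_mul, abs_of_nonneg hf]
  gcongr

/-- Norm each `u k` by Hahn–Banach and cut the functional to the support of `u k`; the sign of `c`
is put into the functional. -/
theorem exists_norming {N : ℕ} {ε : ℝ} {u : ℕ → C00} (hu : IsRIS N ε u) (c : ℝ) :
    ∃ φ ∈ averagedFunctionals N,
      φ (∑ k ∈ Finset.range N, c • u k) = |c| * (N / f N) := by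
  have h : ∀ k, ∃ g : C00 →L[ℝ] ℝ, ‖g‖ ≤ 1 ∧ (∀ a, g (e a) ≠ 0 → a ∈ supp (u k)) ∧
      (k < N → g (∑ k ∈ Finset.range N, c • u k) = |c|) := by
    intro k
    obtain ⟨g, hg, hgu⟩ := exists_dual_vector'' ℝ (u k)
    have hproj : ‖(proj (supp (u k)) : C00 →L[ℝ] C00)‖ ≤ 1 :=
      ContinuousLinearMap.opNorm_le_bound _ zero_le_one fun x => by
        rw [one_mul]
        exact norm_proj_le _ _
    have hsign : ‖(SignType.sign c : ℝ)‖ ≤ 1 := by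
      rcases lt_trichotomy c 0 with h | h | h <;> simp [h]
    refine ⟨(SignType.sign c : ℝ) • g.comp (proj (supp (u k))), ?_, fun a ha => ?_, fun hk => ?_⟩
    · rw [norm_smul]
      exact (mul_le_mul hsign ((ContinuousLinearMap.opNorm_comp_le _ _).trans
        (mul_le_mul hg hproj (norm_nonneg _) zero_le_one)) (norm_nonneg _) zero_le_one).trans
          (by norm_num)
    · by_contra hak
      refine ha ?_
      rw [smul_apply, ContinuousLinearMap.comp_apply, proj_eq_zero, map_zero,
        smul_zero]
      intro b hb hb'
      rw [mem_supp, coord_e] at hb'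
      split_ifs at hb' with h
      · exact hak (h ▸ hb)
      · exact hb' rfl
    · rw [smul_apply, ContinuousLinearMap.comp_apply, ← Finset.smul_sum,
        map_smul, hu.1.proj_sum hk, map_smul, hgu, hu.norm_eq_one hk]
      simp
  choose g hg1 hgs hgu using h
  refine ⟨_, ⟨g, fun i j hij hj a ha b hb => hu.1 i j hij hj a (hgs i a ha) b (hgs j b hb),
    fun i _ => hg1 i, rfl⟩, ?_⟩
  rw [smul_apply, sum_apply,
    Finset.sum_congr rfl fun k hk => hgu k (Finset.mem_range.1 hk)]
  simp only [Finset.sum_const, Finset.card_range, nsmul_eq_mul, smul_eq_mul]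
  ring

/-! ## The asymptotic biorthogonal system in `C00` -/

/-- Since `N ≤ (N / M) ^ 2` and `f` is logarithmic. With it, cutting a sum of length `N` into `M`
parts costs at most a factor two in `N / f N`. -/
theorem f_le_two_mul {N M : ℝ} (hM : 0 < M) (h : M ^ 2 ≤ N) : f N ≤ 2 * f (N / M) := by
  have hN : 0 ≤ N := (sq_nonneg M).trans h
  have h0 : 0 ≤ N / M := by positivity
  have h2 : (2 : ℝ) ^ f (N / M) = N / M + 1 := by
    unfold f
    exact Real.rpow_logb (by norm_num) (by norm_num) (by linarith)
  rw [f_le_iff hN, mul_comm, Real.rpow_mul (by norm_num), h2, Real.rpow_two]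
  have h3 : N ≤ (N / M) ^ 2 := by
    rw [div_pow, le_div_iff₀ (by positivity)]
    nlinarith
  nlinarith

theorem exists_areLengths {δ : ℝ} (hδ : 0 < δ) : ∃ N : ℕ → ℕ, AreLengths δ N := by
  have h0 : ∃ n : ℕ, f n / n < δ / 2 ∧ 8 * δ⁻¹ < f n := by
    have hlim : Tendsto (fun n : ℕ => f n / n) atTop (𝓝 0) := by
      have h1 := (((Real.tendsto_pow_log_div_mul_add_atTop 1 (-1) 1 one_ne_zero).comp
        (tendsto_atTop_add_const_right atTop (1 : ℝ) tendsto_id)).comp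
          (tendsto_natCast_atTop_atTop (R := ℝ))).div_const (Real.log 2)
      rw [zero_div] at h1
      refine h1.congr fun n => ?_
      simp only [Function.comp, id, f_eq]
      ring
    exact ((hlim.eventually (gt_mem_nhds (half_pos hδ))).and
      (tendsto_f.eventually_gt_atTop _)).exists
  obtain ⟨n₀, h1, h2⟩ := h0
  obtain ⟨N, h3, hN⟩ : ∃ N : ℕ → ℕ, N 0 = n₀ ∧ ∀ j, N (j + 1) = max (N j) ⌈Mf (2 * N j)⌉₊ + 1 :=
    ⟨fun j => Nat.rec n₀ (fun _ n => max n ⌈Mf (2 * n)⌉₊ + 1) j, rfl, fun _ => rfl⟩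
  rw [← h3] at h1 h2
  refine ⟨N, strictMono_nat_of_lt_succ fun j => ?_, h1, h2, fun j => ?_⟩
  · rw [hN]
    exact Nat.lt_succ_of_le (le_max_left _ _)
  · rw [hN]
    refine (Nat.le_ceil _).trans_lt ?_
    exact_mod_cast Nat.lt_succ_of_le (le_max_right _ _)

theorem isAsymptoticBiorthogonalSystem_C00 {δ : ℝ} (hδ : 0 < δ) (hδ1 : δ < 1) {N : ℕ → ℕ}
    (hN : AreLengths δ N) :
    IsAsymptoticBiorthogonalSystem δ (fun k => normalizedRISSums δ (N k))
      (fun k => averagedFunctionals (N k)) := by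
  obtain ⟨hmono, hN0, hN8, hgrow⟩ := hN
  have h8 : 8 < f (N 0) := by
    refine lt_of_le_of_lt ?_ hN8
    have : 1 ≤ δ⁻¹ := (one_le_inv₀ hδ).2 hδ1.le
    linarith
  have hN2 : ∀ k, 2 ≤ N k := by
    intro k
    refine le_trans ?_ (hmono.monotone (Nat.zero_le k))
    by_contra h
    have : f (N 0) ≤ 1 := f_one ▸ f_mono (by positivity) (by
      exact_mod_cast (by omega : N 0 ≤ 1))
    linarith
  have hN1 : ∀ k, (1 : ℝ) ≤ N k := fun k => by
    exact_mod_cast (by linarith [hN2 k] : 1 ≤ N k)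
  have hε : min (δ / 2) 1 = δ / 2 := min_eq_left (by linarith)
  have hlt : ∀ k l, k < l → Mf (2 * N k) < N l := fun k l hkl =>
    (hgrow k).trans_le (by exact_mod_cast hmono.monotone hkl)
  have hcle : ∀ k (c : ℝ) (u : ℕ → C00), IsRIS (N k) (δ / 2) u →
      ‖∑ i ∈ Finset.range (N k), c • u i‖ = 1 →
      |c| * ‖∑ i ∈ Finset.range (N k), u i‖ = 1 ∧ |c| ≤ f (N k) / N k := by
    intro k c u hu h1
    have hf := f_pos (hN1 k)
    have hNk : (0 : ℝ) < N k := by linarith [hN1 k]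
    have h2 := hu.le_norm_sum (hN2 k)
    rw [← Finset.smul_sum, norm_smul, Real.norm_eq_abs] at h1
    refine ⟨h1, ?_⟩
    rw [le_div_iff₀ hNk]
    have h3 : |c| * (N k / f (N k)) ≤ 1 := h1 ▸ by gcongr
    rw [← mul_div_assoc, div_le_one hf] at h3
    exact h3
  refine ⟨fun k => averagedFunctionals_subset (hN2 k),
    fun k => isAsymptoticSet_normalizedRISSums hδ (hN2 k), ?_, ?_⟩
  · rintro k x ⟨hx1, c, u, hu, rfl⟩
    obtain ⟨φ, hφ, hφx⟩ := exists_norming hu c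
    refine ⟨φ, hφ, ?_⟩
    rw [hφx]
    have hest := (hu.norm_estimates (half_pos hδ) (by linarith [hN2 k] : 0 < N k)).1
    rw [hε] at hest
    have h1 := (hcle k c u hu hx1).1
    have h2 : 1 ≤ (1 + δ) * (|c| * (N k / f (N k))) := by
      calc 1 = |c| * ‖∑ i ∈ Finset.range (N k), u i‖ := h1.symm
        _ ≤ |c| * ((1 + δ / 2 + δ / 2) * (N k / f (N k))) := by gcongr
        _ = _ := by ring
    nlinarith
  · rintro k l hkl x ⟨hx1, c, u, hu, rfl⟩ φ ⟨g, hg, hg1, rfl⟩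
    obtain ⟨S, hSN, hS⟩ := hg.exists_sets (hN2 l) hg1 (∑ i ∈ Finset.range (N k), u i)
    have hSN' : (S.N : ℝ) = N l := by rw [hSN]
    have hfl := f_pos (hN1 l)
    have hNk : (0 : ℝ) < N k := by linarith [hN1 k]
    have hNl : (0 : ℝ) < N l := by linarith [hN1 l]
    have hc := (hcle k c u hu hx1).2
    have hfk0 : 0 ≤ f (N k) / N k := div_nonneg (f_nonneg hNk.le) hNk.le
    have hφ : |((f (N l))⁻¹ • ∑ i ∈ Finset.range (N l), g i)
          (∑ i ∈ Finset.range (N k), c • u i)| ≤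
        f (N k) / N k * ((f (N l))⁻¹ *
          ∑ i, ‖proj (S.E i) (∑ i ∈ Finset.range (N k), u i)‖) := by
      rw [← Finset.smul_sum, map_smul, smul_apply,
        sum_apply, smul_eq_mul, smul_eq_mul, abs_mul, abs_mul,
        abs_of_pos (inv_pos.2 hfl)]
      gcongr
    refine hφ.trans_lt ?_
    have hfN : f (N k) / N k < δ / 2 := by
      refine lt_of_le_of_lt ?_ hN0
      rw [div_le_div_iff₀ hNk (by linarith [hN1 0]), mul_comm, mul_comm (f _)]
      exact mul_f_le_mul_f (by linarith [hN1 0])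
        (by exact_mod_cast hmono.monotone (Nat.zero_le k))
    rcases lt_or_gt_of_ne hkl with h | h
    -- Many functionals on a short sum: the growth condition is the case `B = 2` of
    -- `RIS_term_le_of_long`, which leaves at most `2`, and normalization multiplies by `f (N k) / N
    -- k < δ / 2`.
    · have hlong : 36 * (N k * 2 : ℝ) ^ 2 ≤ f S.N := by
        rw [mul_comm (N k : ℝ), ← f_Mf, hSN]
        exact f_mono (Mf_nonneg _) (hlt k l h).le
      have hest : (f S.N)⁻¹ * ∑ i, ‖proj (S.E i) (∑ i ∈ Finset.range (N k), u i)‖ ≤ 2 := by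
        obtain ⟨-, n, havg, -, hcard⟩ := hu
        refine (RIS_term_le_of_long (half_pos hδ) havg hcard (by linarith [hN2 k])
          one_le_two S hlong).trans ?_
        rw [hε]
        linarith
      rw [hSN'] at hest
      calc _ ≤ f (N k) / N k * 2 := by
            gcongr
        _ < δ := by linarith
    -- Few functionals on a long sum: after normalization the sum over the sets is bounded by a
    -- constant, so that the smallness comes from `1 / f (N l) < δ / 8`.
    · have hest := (hu.norm_estimates (half_pos hδ) (by linarith [hN2 k] : 0 < N k)).2 S
        (by rw [hSN]; exact hmono.monotone h.le)
      rw [hε, hSN'] at hest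
      have hfk := f_pos (hN1 k)
      have hMN : (N l : ℝ) ^ 2 ≤ N k := by
        have h1 := self_le_Mf (show (1 : ℝ) ≤ 2 * N l by linarith [hN1 l])
        have h2 := hlt l k h
        nlinarith
      have h1 : 1 ≤ (N k : ℝ) / N l := by
        rw [one_le_div hNl]
        nlinarith [hN1 l]
      have hf1 := f_pos h1
      have h2 := f_le_two_mul hNl hMN
      have h3 : f (N k) / f (N k / N l) ≤ 2 := by
        rw [div_le_iff₀ hf1]
        exact h2
      have h4 : (f (N l))⁻¹ < δ / 8 := by
        have h5 : 8 * δ⁻¹ < f (N l) := hN8.trans_le (f_mono (by positivity)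
          (by exact_mod_cast hmono.monotone (Nat.zero_le l)))
        rw [inv_lt_comm₀ hfl (by positivity), inv_div, div_eq_mul_inv]
        exact h5
      have hX : 0 ≤ f (N k) / N k + f (N k) / f (N k / N l) := by positivity
      calc _ ≤ f (N k) / N k * ((f (N l))⁻¹ *
              ((1 + δ / 2 + δ / 2) * (1 + N k / f (N k / N l)))) := by gcongr
        _ = (f (N l))⁻¹ * (1 + δ / 2 + δ / 2) *
              (f (N k) / N k + f (N k) / f (N k / N l)) := by
            field_simp
        _ ≤ δ / 8 * 2 * 3 := by
            gcongr
            · linarith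
            · linarith
        _ < δ := by linarith

end Schlumprecht

/-! ## Renormings by biorthogonal systems -/

section General

variable {X : Type*} [NormedAddCommGroup X] [NormedSpace ℝ X]

/-- The norm `c ‖x‖ + R sup |φ i x|`. -/
theorem exists_seminorm {ι : Type*} (φ : ι → X →L[ℝ] ℝ) {D : ℝ} (hD : 0 ≤ D)
    (hφ : ∀ i, ‖φ i‖ ≤ D) {c R : ℝ} (hc : 0 < c) (hR : 0 ≤ R) :
    ∃ p : Seminorm ℝ X, IsEquivalentNorm p ∧ (∀ x, c * ‖x‖ ≤ p x) ∧
      (∀ i x, R * |φ i x| ≤ p x) ∧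
      ∀ x B, 0 ≤ B → (∀ i, |φ i x| ≤ B) → p x ≤ c * ‖x‖ + R * B := by
  have hle : ∀ i x, |φ i x| ≤ D * ‖x‖ := fun i x => (φ i).le_of_opNorm_le (hφ i) x
  have hbdd : ∀ x, BddAbove (Set.range fun i => |φ i x|) := fun x =>
    ⟨D * ‖x‖, by rintro _ ⟨i, rfl⟩; exact hle i x⟩
  have hnn : ∀ x, 0 ≤ ⨆ i, |φ i x| := fun x => Real.iSup_nonneg fun i => abs_nonneg _
  have hle' : ∀ i x, |φ i x| ≤ ⨆ i, |φ i x| := fun i x => le_ciSup (hbdd x) i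
  let p : Seminorm ℝ X := Seminorm.of (fun x => c * ‖x‖ + R * ⨆ i, |φ i x|)
    (fun x y => by
      have h : ⨆ i, |φ i (x + y)| ≤ (⨆ i, |φ i x|) + ⨆ i, |φ i y| :=
        Real.iSup_le (fun i => by
          rw [map_add]
          exact (abs_add_le _ _).trans (add_le_add (hle' i x) (hle' i y)))
          (add_nonneg (hnn x) (hnn y))
      nlinarith [norm_add_le x y])
    (fun a x => by
      simp only [map_smul, smul_eq_mul, abs_mul, norm_smul, Real.norm_eq_abs]
      rw [← Real.mul_iSup_of_nonneg (abs_nonneg a)]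
      ring)
  have hp : ∀ x, p x = c * ‖x‖ + R * ⨆ i, |φ i x| := fun _ => rfl
  have hup : ∀ x B, 0 ≤ B → (∀ i, |φ i x| ≤ B) → p x ≤ c * ‖x‖ + R * B := fun x B hB h => by
    rw [hp]
    gcongr
    exact Real.iSup_le h hB
  have hlow : ∀ x, c * ‖x‖ ≤ p x := fun x => by
    rw [hp]
    linarith [mul_nonneg hR (hnn x)]
  refine ⟨p, ⟨c, c + R * D, hc, by positivity, fun x => ⟨hlow x, ?_⟩⟩, hlow, fun i x => ?_, hup⟩
  · refine (hup x (D * ‖x‖) (by positivity) fun i => hle i x).trans (le_of_eq (by ring))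
  · rw [hp]
    have := mul_le_mul_of_nonneg_left (hle' i x) hR
    have : 0 ≤ c * ‖x‖ := by positivity
    linarith

/-- The norm `δ ‖x‖ + sup |φ x|` over `φ ∈ A' 0` is at least `1 - δ` on `A 0` and at most `2 * δ` on
`A 1`. Every infinite-dimensional subspace meets both sets. -/
theorem isArbitrarilyDistortable_of_system
    (h : ∀ δ : ℝ, 0 < δ → δ < 1 → ContainsAsymptoticBiorthogonalSystem X δ) :
    IsArbitrarilyDistortable X := by
  intro r
  have hr := abs_nonneg r
  set δ := (2 * |r| + 3)⁻¹ with hδ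
  have hδ0 : 0 < δ := by positivity
  have hδ1 : δ < 1 := inv_lt_one_of_one_lt₀ (by linarith)
  have hδr : δ * (2 * |r| + 3) = 1 := inv_mul_cancel₀ (by positivity)
  obtain ⟨A, A', hA⟩ := h δ hδ0 hδ1
  obtain ⟨p, hp, hlow, hφ, hup⟩ := exists_seminorm (fun φ : A' 0 => (φ : X →L[ℝ] ℝ)) zero_le_one
    (fun φ => mem_closedBall_zero_iff.1 (hA.dual_ball 0 φ.2)) hδ0 zero_le_one
  refine ⟨p, hp, fun Z hZ => ?_⟩
  obtain ⟨y, hy, hyZ⟩ := (hA.asymptotic 0).2 Z hZ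
  obtain ⟨z, hz, hzZ⟩ := (hA.asymptotic 1).2 Z hZ
  have hy1 : ‖y‖ = 1 := mem_sphere_zero_iff_norm.1 ((hA.asymptotic 0).1 hy)
  have hz1 : ‖z‖ = 1 := mem_sphere_zero_iff_norm.1 ((hA.asymptotic 1).1 hz)
  have hpy : 1 - δ ≤ p y := by
    obtain ⟨φ, hφ0, hφy⟩ := hA.norming 0 y hy
    have := hφ ⟨φ, hφ0⟩ y
    rw [one_mul] at this
    linarith [le_abs_self (φ y)]
  have hpz : p z ≤ 2 * δ := by
    have := hup z δ hδ0.le fun φ => (hA.biorthogonal 1 0 one_ne_zero z hz φ φ.2).le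
    rw [hz1] at this
    linarith
  have hpz0 : 0 < p z := by
    have := hlow z
    rw [hz1] at this
    linarith
  obtain ⟨c, K, hc, hK, hcK⟩ := hp
  refine le_csSup_of_le ⟨K / c, ?_⟩ ⟨y, hyZ, z, hzZ, hy1, hz1, rfl⟩ ?_
  · rintro _ ⟨y, -, z, -, hy1, hz1, rfl⟩
    have h1 := (hcK y).2
    have h2 := (hcK z).1
    rw [hy1, mul_one] at h1
    rw [hz1, mul_one] at h2
    gcongr
  · rw [le_div_iff₀ hpz0]
    calc r * p z ≤ |r| * (2 * δ) := by
          gcongr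
          exact le_abs_self r
      _ ≤ 1 - δ := by nlinarith
      _ ≤ p y := hpy

/-! ### Blocks of basic sequences -/

theorem IsBasicSequence.linearIndependent {x : ℕ → X} (hx : IsBasicSequence x) :
    LinearIndependent ℝ x := by
  classical
  rw [linearIndependent_iff']
  intro s g hg i hi
  obtain ⟨a, -, ha⟩ := hx 0 (Submodule.zero_mem _)
  have h0 : (fun _ => 0 : ℕ → ℝ) = a := ha _ (by simp)
  have h1 : (fun j => if j ∈ s then g j else 0) = a := by
    refine ha _ (tendsto_const_nhds.congr' ?_)
    filter_upwards [eventually_gt_atTop (s.sup id)] with n hn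
    have hsub : s ⊆ Finset.range n := fun j hj =>
      Finset.mem_range.2 ((Finset.le_sup (f := id) hj).trans_lt hn)
    rw [← Finset.sum_subset hsub fun j _ hj => by rw [if_neg hj, zero_smul]]
    rw [← hg]
    exact Finset.sum_congr rfl fun j hj => by rw [if_pos hj]
  have h2 := congrFun (h1.trans h0.symm) i
  rwa [if_pos hi] at h2

theorem IsBasicSequence.not_finiteDimensional_tail {x : ℕ → X} (hx : IsBasicSequence x) (m : ℕ) :
    ¬ FiniteDimensional ℝ (Submodule.span ℝ (Set.range fun j => x (m + j))) := by
  intro h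
  have h1 := linearIndependent_span (hx.linearIndependent.comp (fun j => m + j)
    fun i j hij => Nat.add_left_cancel hij)
  have : FiniteDimensional ℝ (Submodule.span ℝ (Set.range (x ∘ fun j => m + j))) := h
  exact not_finite_iff_infinite.2 inferInstance h1.finite

theorem mem_span_tail {x : ℕ → X} {m : ℕ} {y : X}
    (hy : y ∈ Submodule.span ℝ (Set.range fun j => x (m + j))) :
    ∃ m', m ≤ m' ∧ ∃ a : ℕ → ℝ, y = ∑ j ∈ Finset.Ico m m', a j • x j := by
  obtain ⟨c, rfl⟩ := Finsupp.mem_span_range_iff_exists_finsupp.1 hy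
  refine ⟨m + (c.support.sup id + 1), by omega, fun j => c (j - m), ?_⟩
  rw [Finset.sum_Ico_eq_sum_range, Nat.add_sub_cancel_left, Finsupp.sum]
  simp only [Nat.add_sub_cancel_left]
  refine Finset.sum_subset (fun j hj => Finset.mem_range.2
    (Nat.lt_succ_of_le (Finset.le_sup (f := id) hj))) fun j _ hj => ?_
  rw [Finsupp.notMem_support_iff.1 hj, zero_smul]

/-- Signs on blocks are coefficients of absolute value at most one. -/
theorem exists_signed_coefficients (x y : ℕ → X) (m : ℕ → ℕ) (a : ℕ → ℕ → ℝ) (hm0 : m 0 = 0)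
    (hm : ∀ k, m k ≤ m (k + 1)) (hy : ∀ k, y k = ∑ j ∈ Finset.Ico (m k) (m (k + 1)), a k j • x j)
    (r : ℕ) : ∃ α ε : ℕ → ℝ, (∀ j, |ε j| ≤ 1) ∧
      ∑ j ∈ Finset.range (m r), α j • x j = ∑ k ∈ Finset.range r, (-1 : ℝ) ^ k • y k ∧
      ∑ j ∈ Finset.range (m r), (ε j * α j) • x j = ∑ k ∈ Finset.range r, y k := by
  induction r with
  | zero => exact ⟨0, 0, by simp, by simp [hm0], by simp [hm0]⟩
  | succ r ih =>
    obtain ⟨α, ε, hε, h1, h2⟩ := ih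
    refine ⟨fun j => if j < m r then α j else (-1) ^ r * a r j,
      fun j => if j < m r then ε j else (-1) ^ r, fun j => ?_, ?_, ?_⟩
    · dsimp only
      split_ifs
      · exact hε j
      · simp
    · rw [Finset.sum_range_succ, ← h1, hy, ← Finset.sum_range_add_sum_Ico _ (hm r), Finset.smul_sum]
      congr 1
      · exact Finset.sum_congr rfl fun j hj => by
          dsimp only
          rw [if_pos (Finset.mem_range.1 hj)]
      · refine Finset.sum_congr rfl fun j hj => ?_
        dsimp only
        rw [if_neg (not_lt.2 (Finset.mem_Ico.1 hj).1), mul_smul]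
    · rw [Finset.sum_range_succ, ← h2, hy, ← Finset.sum_range_add_sum_Ico _ (hm r)]
      congr 1
      · refine Finset.sum_congr rfl fun j hj => ?_
        dsimp only
        rw [if_pos (Finset.mem_range.1 hj), if_pos (Finset.mem_range.1 hj)]
      · refine Finset.sum_congr rfl fun j hj => ?_
        dsimp only
        rw [if_neg (not_lt.2 (Finset.mem_Ico.1 hj).1), if_neg (not_lt.2 (Finset.mem_Ico.1 hj).1),
          ← mul_assoc, ← pow_add, ← two_mul, pow_mul, neg_one_sq, one_pow, one_mul]

/-- In a separable space countably many functionals are enough. -/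
theorem IsAsymptoticBiorthogonalSystem.exists_countable [TopologicalSpace.SeparableSpace X]
    {δ : ℝ} (hδ : 0 < δ) {A : ℕ → Set X} {A' : ℕ → Set (X →L[ℝ] ℝ)}
    (hA : IsAsymptoticBiorthogonalSystem δ A A') :
    ∃ b : ℕ → ℕ → X →L[ℝ] ℝ, (∀ n i, ‖b n i‖ ≤ 1) ∧
      (∀ n, ∀ x ∈ A n, ∃ i, 1 - δ < b n i x) ∧
      ∀ n m, n ≠ m → ∀ x ∈ A n, ∀ i, |b m i x| < δ := by
  have := UniformSpace.secondCountable_of_separable X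
  have h : ∀ n, ∃ b : ℕ → X →L[ℝ] ℝ, (∀ i, b i = 0 ∨ b i ∈ A' n) ∧
      ∀ x ∈ A n, ∃ i, 1 - δ < b i x := by
    intro n
    obtain ⟨T, hT, hTU⟩ := TopologicalSpace.isOpen_iUnion_countable
      (fun φ : A' n => {x | 1 - δ < (φ : X →L[ℝ] ℝ) x})
      fun φ => isOpen_lt continuous_const (φ : X →L[ℝ] ℝ).continuous
    -- The subfamily given by the Lindelöf property may be empty; adding the zero functional allows
    -- it to be enumerated by `ℕ` and does not harm the bounds.
    obtain ⟨b, hb⟩ := ((hT.image Subtype.val).insert 0).exists_eq_range (Set.insert_nonempty _ _)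
    refine ⟨b, fun i => ?_, fun x hx => ?_⟩
    · have hi : b i ∈ insert 0 (Subtype.val '' T) := hb ▸ Set.mem_range_self i
      rcases hi with h | ⟨φ, -, h⟩
      · exact Or.inl h
      · exact Or.inr (h ▸ φ.2)
    · obtain ⟨φ, hφ, hφx⟩ := hA.norming n x hx
      have hx' : x ∈ ⋃ φ : A' n, {x | 1 - δ < (φ : X →L[ℝ] ℝ) x} :=
        Set.mem_iUnion.2 ⟨⟨φ, hφ⟩, hφx⟩
      rw [← hTU] at hx'
      obtain ⟨ψ, hψ, hψx⟩ := Set.mem_iUnion₂.1 hx'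
      have hmem : (ψ : X →L[ℝ] ℝ) ∈ Set.range b := hb ▸ Or.inr ⟨ψ, hψ, rfl⟩
      obtain ⟨i, hi⟩ := hmem
      exact ⟨i, by rw [hi]; exact hψx⟩
  choose b hb hbA using h
  refine ⟨b, fun n i => ?_, hbA, fun n m hnm x hx i => ?_⟩
  · rcases hb n i with h | h
    · rw [h, norm_zero]
      exact zero_le_one
    · exact mem_closedBall_zero_iff.1 (hA.dual_ball n h)
  · rcases hb m i with h | h
    · simpa [h] using hδ
    · exact hA.biorthogonal n m hnm x hx _ h

/-! ### Coded functionals and the renorming without unconditional sequences -/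

/-- The code of the first `k` terms of a sequence. -/
def prefixCode (i : ℕ → ℕ) (k : ℕ) : ℕ := Encodable.encode ((List.range k).map i)

theorem prefixCode_congr {i j : ℕ → ℕ} {k : ℕ} (h : ∀ t < k, i t = j t) :
    prefixCode i k = prefixCode j k := by
  unfold prefixCode
  congr 1
  exact List.map_congr_left fun t ht => h t (List.mem_range.1 ht)

theorem prefixCode_inj {i j : ℕ → ℕ} {k l : ℕ} (h : prefixCode i k = prefixCode j l) :
    k = l ∧ ∀ t < k, i t = j t := by
  have h1 := Encodable.encode_injective h
  have h2 : k = l := by simpa using congrArg List.length h1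
  subst h2
  refine ⟨rfl, fun t ht => ?_⟩
  exact List.map_inj_left.1 h1 t (List.mem_range.2 ht)

theorem abs_sum_range_neg_one_pow_le (t : ℕ) : |∑ k ∈ Finset.range t, (-1 : ℝ) ^ k| ≤ 1 := by
  rw [neg_one_geom_sum]
  split_ifs <;> simp

theorem abs_sum_sub_le {r : ℕ} {c : ℝ} {u v : ℕ → ℝ} (h : ∀ k < r, |u k - v k| ≤ c) :
    |∑ k ∈ Finset.range r, u k - ∑ k ∈ Finset.range r, v k| ≤ r * c := by
  rw [← Finset.sum_sub_distrib]
  refine (Finset.abs_sum_le_sum_abs _ _).trans ?_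
  refine (Finset.sum_le_card_nsmul _ _ c fun k hk => h k (Finset.mem_range.1 hk)).trans ?_
  simp

/-- The new norm adds to the old one `r` times the supremum of the coded functionals. Blocks `y k`
that follow one coded sequence satisfy `p (∑ y k) ≥ r * (r - 1 / 4)`, whereas their alternating sum
has norm at most `4 * r`. As `r > 4 * |C| + 1`, changing signs violates `C`-unconditionality. -/
theorem hasNormWithoutUnconditionalBasicSequence_of_system [TopologicalSpace.SeparableSpace X]
    (h : ∀ δ : ℝ, 0 < δ → δ < 1 → ContainsAsymptoticBiorthogonalSystem X δ) (C : ℝ) :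
    HasNormWithoutUnconditionalBasicSequence X C := by
  obtain ⟨r, hr⟩ := exists_nat_gt (4 * |C| + 1)
  have hr1 : (1 : ℝ) < r := by linarith [abs_nonneg C]
  -- There are at most `r ^ 2` error terms, so that their total stays below `1 / 4`.
  set δ : ℝ := 1 / (4 * r ^ 2) with hδ
  have hδ0 : 0 < δ := by positivity
  have hδ1 : δ < 1 := by
    rw [hδ, div_lt_one (by positivity)]
    nlinarith
  have hrδ : r * (r * δ) = 1 / 4 := by
    rw [hδ]
    field_simp
  have hrδ' : r * δ ≤ 1 / 4 := by nlinarith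
  obtain ⟨A, A', hA⟩ := h δ hδ0 hδ1
  obtain ⟨b, hb1, hbn, hbo⟩ := hA.exists_countable hδ0
  have hA1 : ∀ n, ∀ y ∈ A n, ‖y‖ = 1 := fun n y hy =>
    mem_sphere_zero_iff_norm.1 ((hA.asymptotic n).1 hy)
  -- The `k`-th functional comes from the family numbered by the code of the earlier choices `i 0,
  -- …, i (k - 1)`. Hence two sequences use different families from the step after their first
  -- disagreement on.
  let z : (ℕ → ℕ) → ℕ → X →L[ℝ] ℝ := fun i k => b (prefixCode i k) (i k)
  obtain ⟨p, hp, -, hpl, hpu⟩ := exists_seminorm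
    (fun i : ℕ → ℕ => ∑ k ∈ Finset.range r, z i k) (D := r) (by positivity) (fun i => by
      refine (norm_sum_le _ _).trans
        ((Finset.sum_le_card_nsmul _ _ 1 fun k _ => hb1 _ _).trans ?_)
      simp) one_pos (show (0 : ℝ) ≤ r by positivity)
  refine ⟨p, hp, fun x hx => ?_⟩
  obtain ⟨hbasic, hunc⟩ := hx
  -- Given the indices chosen so far, the next block is taken from the asymptotic set numbered by
  -- their code, in the linear span of a tail. That span consists of finite combinations, so the
  -- result is a genuine block of `x`.
  have hstep : ∀ (l : List ℕ) (m : ℕ), ∃ (y : X) (i m' : ℕ) (a : ℕ → ℝ),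
      y ∈ A (Encodable.encode l) ∧ 1 - δ < b (Encodable.encode l) i y ∧ m ≤ m' ∧
        y = ∑ j ∈ Finset.Ico m m', a j • x j := by
    intro l m
    obtain ⟨y, hy, hyx⟩ := (hA.asymptotic (Encodable.encode l)).2 _
      (hbasic.not_finiteDimensional_tail m)
    obtain ⟨i, hi⟩ := hbn _ y hy
    obtain ⟨m', hm', a, ha⟩ := mem_span_tail hyx
    exact ⟨y, i, m', a, hy, hi, hm', ha⟩
  choose Y I M a hYA hYI hM hYa using hstep
  obtain ⟨s, hs0, hs⟩ : ∃ s : ℕ → List ℕ × ℕ, s 0 = ([], 0) ∧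
      ∀ k, s (k + 1) = ((s k).1 ++ [I (s k).1 (s k).2], M (s k).1 (s k).2) :=
    ⟨fun k => Nat.rec ([], 0) (fun _ q => (q.1 ++ [I q.1 q.2], M q.1 q.2)) k, rfl, fun _ => rfl⟩
  let i₀ : ℕ → ℕ := fun k => I (s k).1 (s k).2
  let y : ℕ → X := fun k => Y (s k).1 (s k).2
  have hs1 : ∀ k, (s k).1 = (List.range k).map i₀ := by
    intro k
    induction k with
    | zero => simp [hs0]
    | succ k ih =>
      rw [hs, List.range_succ, List.map_append, ← ih]
      rfl
  have hcode : ∀ k, Encodable.encode (s k).1 = prefixCode i₀ k := fun k => by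
    rw [hs1]
    rfl
  have hyA : ∀ k, y k ∈ A (prefixCode i₀ k) := fun k => hcode k ▸ hYA _ _
  have hyz : ∀ k, 1 - δ < z i₀ k (y k) := fun k => by
    have := hYI (s k).1 (s k).2
    rw [hcode] at this
    exact this
  have hy1 : ∀ k, ‖y k‖ = 1 := fun k => hA1 _ _ (hyA k)
  have hz1 : ∀ i k l, |z i k (y l)| ≤ 1 := fun i k l => by
    have := (z i k).le_of_opNorm_le_of_le (hb1 _ _) (hy1 l).le
    rwa [one_mul] at this
  have hzo : ∀ i k l, prefixCode i k ≠ prefixCode i₀ l → |z i k (y l)| < δ := fun i k l hne =>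
    hbo _ _ hne.symm _ (hyA l) _
  have hzo' : ∀ i k l, k ≠ l → |z i k (y l)| < δ := fun i k l hne =>
    hzo i k l fun h => hne (prefixCode_inj h).1
  obtain ⟨α, ε, hε, hα, hεα⟩ := exists_signed_coefficients x y (fun k => (s k).2)
    (fun k => a (s k).1 (s k).2) (by rw [hs0]) (fun k => by rw [hs]; exact hM _ _)
    (fun k => by
      rw [hs]
      exact hYa _ _) r
  have hineq := hunc (s r).2 α ε hε
  rw [hα, hεα] at hineq
  have hlower : r * (r - 1 / 4) ≤ p (∑ k ∈ Finset.range r, y k) := by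
    refine le_trans ?_ (hpl i₀ _)
    gcongr
    refine le_trans ?_ (le_abs_self _)
    rw [sum_apply]
    have h1 : ∀ k < r, |z i₀ k (∑ l ∈ Finset.range r, y l) - 1| ≤ r * δ := by
      intro k hk
      have h2 : (1 : ℝ) = ∑ l ∈ Finset.range r, if l = k then 1 else 0 := by
        rw [Finset.sum_ite_eq', if_pos (Finset.mem_range.2 hk)]
      rw [map_sum]
      conv_lhs => rw [h2]
      refine abs_sum_sub_le fun l _ => ?_
      split_ifs with hl
      · rw [hl, abs_le]
        constructor
        · linarith [hyz k]
        · linarith [le_abs_self (z i₀ k (y k)), hz1 i₀ k k]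
      · rw [sub_zero]
        exact (hzo' i₀ k l (Ne.symm hl)).le
    have h3 := abs_le.1 (abs_sum_sub_le h1)
    simp only [Finset.sum_const, Finset.card_range, nsmul_eq_mul, mul_one] at h3
    linarith [h3.1]
  have hupper : p (∑ k ∈ Finset.range r, (-1 : ℝ) ^ k • y k) ≤ 4 * r := by
    have hnorm : ‖∑ k ∈ Finset.range r, (-1 : ℝ) ^ k • y k‖ ≤ r := by
      refine (norm_sum_le _ _).trans ((Finset.sum_le_card_nsmul _ _ 1 fun k _ => ?_).trans ?_)
      · rw [norm_smul, hy1]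
        simp
      · simp
    refine (hpu _ 3 (by norm_num) fun i => ?_).trans (by linarith)
    -- Let `t` be the first disagreement of `i` with `i₀`, or `r` if there is none. Before `t` the
    -- functionals coincide and give a partial alternating sum of size at most one. At `t` the
    -- families still agree but the functionals may not, which costs at most one more. After `t` the
    -- families differ and biorthogonality applies.
    obtain ⟨t, ht, htr⟩ : ∃ t, (∀ k < t, i k = i₀ k) ∧ (t < r → i t ≠ i₀ t) := by
      by_cases hex : ∃ k, i k ≠ i₀ k
      · classical
        exact ⟨Nat.find hex, fun k hk => not_not.1 (Nat.find_min hex hk),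
          fun _ => Nat.find_spec hex⟩
      · push Not at hex
        exact ⟨r, fun k _ => hex k, fun h => absurd h (lt_irrefl _)⟩
    rw [sum_apply]
    have h1 : ∀ k < r, |z i k (∑ l ∈ Finset.range r, (-1 : ℝ) ^ l • y l) -
        (-1) ^ k * z i k (y k)| ≤ r * δ := by
      intro k hk
      have h2 : (-1) ^ k * z i k (y k) =
          ∑ l ∈ Finset.range r, if l = k then (-1) ^ k * z i k (y k) else 0 := by
        rw [Finset.sum_ite_eq', if_pos (Finset.mem_range.2 hk)]
      rw [map_sum]
      conv_lhs => rw [h2]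
      refine abs_sum_sub_le fun l _ => ?_
      rw [map_smul, smul_eq_mul]
      split_ifs with hl
      · rw [hl, sub_self, abs_zero]
        exact hδ0.le
      · rw [sub_zero, abs_mul, abs_pow, abs_neg, abs_one, one_pow, one_mul]
        exact (hzo' i k l (Ne.symm hl)).le
    have h3 := abs_sum_sub_le h1
    have h4 : |∑ k ∈ Finset.range r, (-1) ^ k * z i k (y k) -
        ∑ k ∈ Finset.range r, if k < t then (-1 : ℝ) ^ k else 0| ≤ r * δ + 1 := by
      rw [← Finset.sum_sub_distrib]
      refine (Finset.abs_sum_le_sum_abs _ _).trans ?_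
      have h5 : ∀ k ∈ Finset.range r, |(-1) ^ k * z i k (y k) - if k < t then (-1 : ℝ) ^ k else 0| ≤
          δ + if k = t then 1 else 0 := by
        intro k hk
        rcases lt_trichotomy k t with hkt | hkt | hkt
        · rw [if_pos hkt, if_neg hkt.ne, add_zero]
          have hz : z i k = z i₀ k := by
            simp only [z]
            rw [prefixCode_congr fun j hj => ht j (hj.trans hkt), ht k hkt]
          have h6 : (-1) ^ k * z i k (y k) - (-1 : ℝ) ^ k = (-1) ^ k * (z i k (y k) - 1) := by ring
          rw [h6, abs_mul, abs_pow, abs_neg, abs_one, one_pow, one_mul, hz, abs_le]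
          constructor
          · linarith [hyz k]
          · linarith [le_abs_self (z i₀ k (y k)), hz1 i₀ k k]
        · rw [if_neg (by omega), if_pos hkt, sub_zero, abs_mul, abs_pow, abs_neg, abs_one, one_pow,
            one_mul]
          linarith [hz1 i k k]
        · rw [if_neg (by omega), if_neg hkt.ne', sub_zero, add_zero, abs_mul, abs_pow, abs_neg,
            abs_one, one_pow, one_mul]
          refine (hzo i k k fun hc => ?_).le
          exact htr (hkt.trans (Finset.mem_range.1 hk)) ((prefixCode_inj hc).2 t hkt)
      refine (Finset.sum_le_sum h5).trans ?_
      rw [Finset.sum_add_distrib, Finset.sum_const, Finset.card_range, nsmul_eq_mul,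
        Finset.sum_ite_eq']
      split_ifs <;> linarith
    have h7 : |∑ k ∈ Finset.range r, if k < t then (-1 : ℝ) ^ k else 0| ≤ 1 := by
      rw [← Finset.sum_filter]
      have h8 : (Finset.range r).filter (fun k => k < t) = Finset.range (min r t) := by
        ext k
        simp
      rw [h8]
      exact abs_sum_range_neg_one_pow_le _
    rw [abs_le] at h3 h4 h7 ⊢
    constructor <;> linarith [h3.1, h3.2, h4.1, h4.2, h7.1, h7.2]
  have h9 : C * p (∑ k ∈ Finset.range r, (-1 : ℝ) ^ k • y k) ≤ |C| * (4 * r) :=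
    mul_le_mul (le_abs_self C) hupper (apply_nonneg p _) (abs_nonneg C)
  have h10 : r * (r - 1 / 4) ≤ r * (4 * |C|) := by linarith
  have h11 := le_of_mul_le_mul_left h10 (by linarith)
  linarith

end General

namespace Schlumprecht
open C00

/-! ## The completion -/

instance : TopologicalSpace.SeparableSpace C00 := by
  rw [← TopologicalSpace.isSeparable_univ_iff]
  refine ((Set.countable_range e).isSeparable.span (R := ℝ)).mono fun x _ => ?_
  rw [SetLike.mem_coe, eq_sum x]
  exact Submodule.sum_mem _ fun a _ =>
    Submodule.smul_mem _ _ (Submodule.subset_span (Set.mem_range_self a))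

/-- The extension of a functional to the completion. -/
noncomputable def extendFunctional (φ : C00 →L[ℝ] ℝ) : Space →L[ℝ] ℝ :=
  φ.extend (UniformSpace.Completion.toComplL (𝕜 := ℝ) (E := C00))

theorem extendFunctional_coe (φ : C00 →L[ℝ] ℝ) (x : C00) :
    extendFunctional φ (x : Space) = φ x :=
  φ.extend_eq (e := UniformSpace.Completion.toComplL) UniformSpace.Completion.denseRange_coe
    (UniformSpace.Completion.isUniformInducing_coe C00) x

theorem norm_extendFunctional_le (φ : C00 →L[ℝ] ℝ) : ‖extendFunctional φ‖ ≤ ‖φ‖ := by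
  have := φ.opNorm_extend_le (e := UniformSpace.Completion.toComplL) (N := 1)
    UniformSpace.Completion.denseRange_coe fun x => by
      rw [NNReal.coe_one, one_mul]
      exact (UniformSpace.Completion.norm_coe x).ge
  rwa [NNReal.coe_one, one_mul] at this

/-- The coordinate functionals. -/
noncomputable def coordL (a : ℕ) : C00 →L[ℝ] ℝ :=
  LinearMap.mkContinuous
    { toFun := fun x => x.coord a
      map_add' := fun x y => coord_add x y a
      map_smul' := fun c x => coord_smul c x a } 1
    fun x => by
      rw [one_mul]
      exact abs_coord_le x a

theorem coordL_apply (a : ℕ) (x : C00) : coordL a x = x.coord a := rfl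

/-- Elements of `Y` need not be finitely supported. One takes a unit vector of `Y` whose first `m`
coordinates vanish, approximates it by `w` in `C00`, and removes the first `m` coordinates of `w`,
which are small by continuity. -/
theorem exists_near {Y : Submodule ℝ Space} (hY : ¬ FiniteDimensional ℝ Y) {η : ℝ} (hη : 0 < η)
    (m : ℕ) : ∃ v : C00, (∃ y ∈ Y, ‖y‖ = 1 ∧ ‖y - v‖ ≤ η) ∧ ∀ a ∈ supp v, m ≤ a := by
  obtain ⟨y, hy, h0, hT⟩ := exists_mem_ne_zero_of_not_finiteDimensional hY (m := m)
    (LinearMap.pi fun i => (extendFunctional (coordL i)).toLinearMap)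
  set y' := ‖y‖⁻¹ • y with hy'
  have hcoord : ∀ a < m, extendFunctional (coordL a) y' = 0 := fun a ha => by
    have : extendFunctional (coordL a) y = 0 := congrFun hT ⟨a, ha⟩
    rw [hy', map_smul, this, smul_zero]
  let P : Space → Space := fun z =>
    ∑ a ∈ Finset.range m, extendFunctional (coordL a) z • ((e a : C00) : Space)
  have hP : Continuous P := by
    fun_prop
  have hPy : P y' = 0 := Finset.sum_eq_zero fun a ha => by
    rw [hcoord a (Finset.mem_range.1 ha), zero_smul]
  have hPw : ∀ w : C00, P w = (proj (Finset.range m) w : C00) := by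
    intro w
    have h1 : proj (Finset.range m) w = ∑ a ∈ Finset.range m, w.coord a • e a := by
      ext b
      simp [coord_e]
    rw [h1]
    simp only [P, extendFunctional_coe, coordL_apply]
    have h2 := map_sum (UniformSpace.Completion.toComplL (𝕜 := ℝ) (E := C00))
      (fun a => w.coord a • e a) (Finset.range m)
    simp only [map_smul] at h2
    exact h2.symm
  have hopen : IsOpen {z : Space | ‖y' - z‖ < η / 2 ∧ ‖P z‖ < η / 2} :=
    (isOpen_lt (continuous_const.sub continuous_id).norm continuous_const).and
      (isOpen_lt hP.norm continuous_const)
  obtain ⟨w, hw1, hw2⟩ := UniformSpace.Completion.denseRange_coe.exists_mem_open hopen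
    ⟨y', by simpa using hη, by simpa [hPy] using hη⟩
  refine ⟨w - proj (Finset.range m) w, ⟨y', Y.smul_mem _ hy, norm_smul_inv_norm h0, ?_⟩,
    fun a ha => ?_⟩
  · rw [UniformSpace.Completion.coe_sub, ← hPw, ← sub_add]
    exact (norm_add_le _ _).trans (by linarith)
  · by_contra hlt
    rw [mem_supp, coord_sub, coord_proj, if_pos (Finset.mem_range.2 (not_le.1 hlt)), sub_self] at ha
    exact ha rfl

theorem linearIndependent_of_successive {v : ℕ → C00}
    (hv : ∀ i j, i < j → ∀ a ∈ supp (v i), ∀ b ∈ supp (v j), a < b) (h0 : ∀ j, v j ≠ 0) :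
    LinearIndependent ℝ v := by
  rw [linearIndependent_iff']
  intro s g hg i hi
  by_contra hne
  obtain ⟨a, ha⟩ := supp_nonempty (smul_ne_zero hne (h0 i))
  have h1 := coord_sum_of_successive (v := fun j => g j • v j)
    (fun i j hij a ha b hb => hv i j hij a (supp_smul_subset _ _ ha) b (supp_smul_subset _ _ hb))
    hi ha
  rw [hg, coord_zero] at h1
  exact mem_supp.1 ha h1.symm

theorem norm_le_norm_sum_of_successive {v : ℕ → C00}
    (hv : ∀ i j, i < j → ∀ a ∈ supp (v i), ∀ b ∈ supp (v j), a < b) {s : Finset ℕ} {i : ℕ}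
    (hi : i ∈ s) : ‖v i‖ ≤ ‖∑ j ∈ s, v j‖ := by
  refine norm_mono fun a => ?_
  by_cases ha : a ∈ supp (v i)
  · rw [coord_sum_of_successive hv hi ha]
  · rw [mem_supp, not_not] at ha
    rw [ha, abs_zero]
    exact abs_nonneg _

/-- Approximate a sequence in `Y` by successive vectors `v j` with rapidly decreasing errors. The
span of the `v j` in `C00` meets `A`, and the same combination of vectors of `Y` is close to that
point; normalizing it doubles the error bound. -/
theorem exists_near_asymptotic {A : Set C00} (hA : IsAsymptoticSet A) {Y : Submodule ℝ Space}
    (hY : ¬ FiniteDimensional ℝ Y) {η : ℝ} (hη : 0 < η) (hη1 : η < 1) :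
    ∃ y ∈ Y, ‖y‖ = 1 ∧ ∃ x ∈ A, ‖y - (x : Space)‖ ≤ 2 * η := by
  obtain ⟨v, hv0, hv1, hsucc, -⟩ := exists_successive
    (fun j _ v => ∃ y ∈ Y, ‖y‖ = 1 ∧ ‖y - (v : Space)‖ ≤ η / 4 * (1 / 2) ^ j) 0
    fun j _ m => exists_near hY (by positivity) m
  have hv : ∀ j, ∃ y ∈ Y, ‖y‖ = 1 ∧ ‖y - (v j : Space)‖ ≤ η / 4 * (1 / 2) ^ j := fun j => by
    cases j with
    | zero => exact hv0
    | succ j => exact hv1 j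
  choose y hyY hy1 hyv using hv
  have hvn : ∀ j, 1 / 2 ≤ ‖v j‖ := fun j => by
    have h1 := norm_sub_norm_le (y j) (v j : Space)
    rw [hy1, UniformSpace.Completion.norm_coe] at h1
    have h2 : η / 4 * (1 / 2) ^ j ≤ η / 4 * 1 := by
      gcongr
      exact pow_le_one₀ (by norm_num) (by norm_num)
    linarith [hyv j]
  have hli := linearIndependent_of_successive hsucc fun j => norm_pos_iff.1
    (by linarith [hvn j])
  have hinf : ¬ FiniteDimensional ℝ (Submodule.span ℝ (Set.range v)) := fun h =>
    not_finite_iff_infinite.2 inferInstance (linearIndependent_span hli).finite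
  obtain ⟨x, hxA, hxV⟩ := hA.2 _ hinf
  have hx1 : ‖x‖ = 1 := mem_sphere_zero_iff_norm.1 (hA.1 hxA)
  obtain ⟨c, hc⟩ := Finsupp.mem_span_range_iff_exists_finsupp.1 hxV
  rw [Finsupp.sum] at hc
  -- The norm of each term is at most that of the sum, which is one, and `‖v j‖ ≥ 1 / 2`. The
  -- coefficient bound makes the errors summable with total at most `η`.
  have hc2 : ∀ j ∈ c.support, |c j| ≤ 2 := fun j hj => by
    have h1 := norm_le_norm_sum_of_successive (v := fun j => c j • v j)
      (fun i j hij a ha b hb =>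
        hsucc i j hij a (supp_smul_subset _ _ ha) b (supp_smul_subset _ _ hb)) hj
    rw [hc, hx1, norm_smul, Real.norm_eq_abs] at h1
    nlinarith [hvn j, abs_nonneg (c j)]
  set z := ∑ j ∈ c.support, c j • y j with hz
  have hzY : z ∈ Y := Y.sum_mem fun j _ => Y.smul_mem _ (hyY j)
  have hxz : ‖z - (x : Space)‖ ≤ η := by
    have h1 : (x : Space) = ∑ j ∈ c.support, c j • (v j : Space) := by
      have h2 := map_sum (UniformSpace.Completion.toComplL (𝕜 := ℝ) (E := C00))
        (fun j => c j • v j) c.support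
      simp only [map_smul] at h2
      rw [← hc]
      exact h2
    rw [hz, h1, ← Finset.sum_sub_distrib]
    calc ‖∑ j ∈ c.support, (c j • y j - c j • (v j : Space))‖
        ≤ ∑ j ∈ c.support, ‖c j • y j - c j • (v j : Space)‖ := norm_sum_le _ _
      _ ≤ ∑ j ∈ c.support, η / 2 * (1 / 2) ^ j := Finset.sum_le_sum fun j hj => by
          rw [← smul_sub, norm_smul, Real.norm_eq_abs]
          calc |c j| * ‖y j - (v j : Space)‖ ≤ 2 * (η / 4 * (1 / 2) ^ j) :=
                mul_le_mul (hc2 j hj) (hyv j) (norm_nonneg _) (by norm_num)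
            _ = η / 2 * (1 / 2) ^ j := by ring
      _ = η / 2 * ∑ j ∈ c.support, (1 / 2 : ℝ) ^ j := by rw [Finset.mul_sum]
      _ ≤ η / 2 * 2 := by
          gcongr
          refine le_of_le_of_eq ?_ tsum_geometric_two
          exact summable_geometric_two.sum_le_tsum _ fun j _ => by positivity
      _ = η := by ring
  have hzn : |1 - ‖z‖| ≤ η := by
    have h1 := abs_norm_sub_norm_le z (x : Space)
    rw [UniformSpace.Completion.norm_coe, hx1, abs_sub_comm] at h1
    exact h1.trans hxz
  have hz0 : z ≠ 0 := by
    rintro h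
    rw [h, norm_zero, sub_zero, abs_one] at hzn
    linarith
  refine ⟨‖z‖⁻¹ • z, Y.smul_mem _ hzY, norm_smul_inv_norm hz0, x, hxA, ?_⟩
  have hz1 : ‖‖z‖⁻¹ • z - z‖ = |1 - ‖z‖| := by
    have hpos : 0 < ‖z‖ := norm_pos_iff.2 hz0
    have h1 : ‖z‖⁻¹ • z - z = (‖z‖⁻¹ - 1) • z := by rw [sub_smul, one_smul]
    rw [h1, norm_smul, Real.norm_eq_abs]
    conv_lhs => rw [← abs_of_pos hpos, ← abs_mul]
    rw [abs_of_pos hpos, sub_mul, inv_mul_cancel₀ hpos.ne', one_mul]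
  calc ‖‖z‖⁻¹ • z - (x : Space)‖ ≤ ‖‖z‖⁻¹ • z - z‖ + ‖z - (x : Space)‖ :=
        norm_sub_le_norm_sub_add_norm_sub _ _ _
    _ ≤ 2 * η := by
      rw [hz1]
      linarith

theorem containsAsymptoticBiorthogonalSystem_C00 {δ : ℝ} (hδ : 0 < δ) (hδ1 : δ < 1) :
    ContainsAsymptoticBiorthogonalSystem C00 δ := by
  obtain ⟨N, hN⟩ := exists_areLengths hδ
  exact ⟨_, _, isAsymptoticBiorthogonalSystem_C00 hδ hδ1 hN⟩

/-- Start from a system with constant `δ / 2` in `C00`, replace its sets by their `δ /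
4`-neighbourhoods in the unit sphere of the completion, and extend the functionals. Evaluations
change by at most `δ / 4`. -/
theorem containsAsymptoticBiorthogonalSystem_space {δ : ℝ} (hδ : 0 < δ) (hδ1 : δ < 1) :
    ContainsAsymptoticBiorthogonalSystem Space δ := by
  obtain ⟨A, A', hA⟩ := containsAsymptoticBiorthogonalSystem_C00 (half_pos hδ) (by linarith)
  have hdiff : ∀ n, ∀ φ ∈ A' n, ∀ (y : Space) (x : C00), ‖y - (x : Space)‖ ≤ δ / 4 →
      |extendFunctional φ y - φ x| ≤ δ / 4 := by
    intro n φ hφ y x hyx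
    rw [← extendFunctional_coe, ← map_sub]
    have h1 := mem_closedBall_zero_iff.1 (hA.dual_ball n hφ)
    have h2 := (extendFunctional φ).le_of_opNorm_le_of_le
      ((norm_extendFunctional_le φ).trans h1) hyx
    rwa [one_mul] at h2
  refine ⟨fun n => {y | ‖y‖ = 1 ∧ ∃ x ∈ A n, ‖y - (x : Space)‖ ≤ δ / 4},
    fun n => extendFunctional '' A' n, ?_, fun n => ⟨?_, fun Y hY => ?_⟩, ?_, ?_⟩
  · rintro n _ ⟨φ, hφ, rfl⟩
    exact mem_closedBall_zero_iff.2 ((norm_extendFunctional_le φ).trans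
      (mem_closedBall_zero_iff.1 (hA.dual_ball n hφ)))
  · exact fun y hy => mem_sphere_zero_iff_norm.2 hy.1
  · obtain ⟨y, hy, hy1, x, hx, hyx⟩ := exists_near_asymptotic (hA.asymptotic n) hY
      (show 0 < δ / 8 by positivity) (by linarith)
    exact ⟨y, ⟨hy1, x, hx, hyx.trans (by linarith)⟩, hy⟩
  · rintro n y ⟨-, x, hx, hyx⟩
    obtain ⟨φ, hφ, hφx⟩ := hA.norming n x hx
    refine ⟨_, ⟨φ, hφ, rfl⟩, ?_⟩
    have := (abs_le.1 (hdiff n φ hφ y x hyx)).1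
    linarith
  · rintro n m hnm y ⟨-, x, hx, hyx⟩ _ ⟨φ, hφ, rfl⟩
    have h1 := abs_le.1 (hdiff m φ hφ y x hyx)
    have h2 := abs_lt.1 (hA.biorthogonal n m hnm x hx φ hφ)
    rw [abs_lt]
    constructor <;> linarith [h1.1, h1.2, h2.1, h2.2]

end Schlumprecht

theorem mainTheorem3 :
    (∀ δ : ℝ, 0 < δ → δ < 1 →
      (∃ N : ℕ → ℕ, Schlumprecht.AreLengths δ N) ∧
      (∀ N : ℕ → ℕ, Schlumprecht.AreLengths δ N →
        IsAsymptoticBiorthogonalSystem δ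
          (fun k => Schlumprecht.normalizedRISSums δ (N k))
          (fun k => Schlumprecht.averagedFunctionals (N k))) ∧
      ContainsAsymptoticBiorthogonalSystem Schlumprecht.Space δ) ∧
    (∀ C : ℝ, HasNormWithoutUnconditionalBasicSequence Schlumprecht.C00 C ∧
      HasNormWithoutUnconditionalBasicSequence Schlumprecht.Space C) ∧
    IsArbitrarilyDistortable Schlumprecht.C00 ∧
    IsArbitrarilyDistortable Schlumprecht.Space := by
  have h1 := fun δ h0 h1 => Schlumprecht.containsAsymptoticBiorthogonalSystem_C00 (δ := δ) h0 h1
  have h2 := fun δ h0 h1 => Schlumprecht.containsAsymptoticBiorthogonalSystem_space (δ := δ) h0 h1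
  exact ⟨fun δ hδ hδ1 => ⟨Schlumprecht.exists_areLengths hδ,
      fun N hN => Schlumprecht.isAsymptoticBiorthogonalSystem_C00 hδ hδ1 hN, h2 δ hδ hδ1⟩,
    fun C => ⟨hasNormWithoutUnconditionalBasicSequence_of_system h1 C,
      hasNormWithoutUnconditionalBasicSequence_of_system h2 C⟩,
    isArbitrarilyDistortable_of_system h1, isArbitrarilyDistortable_of_system h2⟩
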